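/- All trees here are simple undirected graphs that are connected and acyclic. An embedding of a tree $S$ into a tree $T$ is an injective map of vertices that preserves adjacency. Two trees are equimorphic (siblings) if each embeds into the other, and $\mathrm{Sib}(T)\in\mathbb{N}\cup\{\infty\}$ is the number of isomorphism classes of trees equimorphic to $T$. A ray is a one-way infinite path; two rays of $T$ are equivalent if their intersection is again a ray, and the ends of $T$ are the equivalence classes of its rays. An embedding $f:T\to T$ is elliptic if $f(F)=F$ for some non-empty finite subtree $F$ of $T$. It fixes an end $\eta$ if $f(R)\in\eta$ for every ray $R\in\eta$, and it is parabolic if it is not elliptic and fixes precisely one end. A vertex $r$ separates a vertex $x$ from an end $\eta$ if the ray in $\eta$ that starts at $x$ passes through $r$, and a sequence of vertices $(x_n)$ converges to $\eta$ if there is a ray $r_0r_1\cdots$ in $\eta$ such that for every $m$, the vertex $r_m$ separates $x_n$ from $\eta$ for only finitely many $n$. The direction $f^+$ of a non-elliptic embedding $f$ is the unique end that is fixed by $f$ and to which, for every vertex $x$, the sequence $x, f(x), f^2(x),\ldots$ converges. For a ray $R$ of $T$ and a vertex $r$ of $R$, let $T^R_r$ be the maximal subtree of $T$ that contains $r$ and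 is edge-disjoint from $R$. The ray $R$ is regular if the trees $T^R_r$, $r\in R$, fall into only finitely many equimorphy classes, and an end is regular if it contains a regular ray. **Lemma.** Let $T$ be a locally finite tree which is not a ray, and let $f$ be a parabolic embedding of $T$. If the direction $f^+$ is regular, then $\mathrm{Sib}(T)=\infty$. -/

import Mathlib

open SimpleGraph

universe u v

namespace TreeSib

/-- Two graphs are equimorphic (siblings) if each embeds in the other. An embedding is an injective
map of vertices that preserves adjacency, which is Mathlib's `SimpleGraph.Copy`. -/
def Equimorphic {V : Type u} {W : Type v} (S : SimpleGraph V) (T : SimpleGraph W) : Prop :=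
  Nonempty (Copy S T) ∧ Nonempty (Copy T S)

/-- The siblings of `T`: the trees that are equimorphic to `T`. Since a sibling embeds in `T`,
every sibling is isomorphic to one whose vertex type lies in the universe of `V`. -/
structure Sibling {V : Type u} (T : SimpleGraph V) : Type (u + 1) where
  verts : Type u
  graph : SimpleGraph verts
  isTree : graph.IsTree
  equimorphic : Equimorphic graph T

/-- Isomorphism of siblings. -/
instance Sibling.setoid {V : Type u} (T : SimpleGraph V) : Setoid (Sibling T) where
  r A B := Nonempty (A.graph ≃g B.graph)
  iseqv := ⟨fun _ => ⟨Iso.refl⟩, fun ⟨e⟩ => ⟨e.symm⟩, fun ⟨e⟩ ⟨e'⟩ => ⟨e.trans e'⟩⟩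

/-- `Sib(T)`, the number of isomorphism classes of siblings of `T`. -/
noncomputable def siblingNumber {V : Type u} (T : SimpleGraph V) : ℕ∞ :=
  ENat.card (Quotient (Sibling.setoid T))

/-- The one-way infinite path `0 - 1 - 2 - ⋯`. -/
abbrev rayGraph : SimpleGraph ℕ := hasse ℕ

/-- A tree is a ray if it is a one-way infinite path. -/
def IsRay {V : Type u} (T : SimpleGraph V) : Prop := Nonempty (T ≃g rayGraph)

/-- The rays in `T`. The vertices of the ray `R`, from its starting vertex on, are
`R 0, R 1, R 2, …`; as a subgraph of `T` it is `R.toSubgraph`. -/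
abbrev Ray {V : Type u} (T : SimpleGraph V) : Type u := Copy rayGraph T

/-- Two rays are equivalent if their intersection is also a ray. -/
def RayEquiv {V : Type u} {T : SimpleGraph V} (R S : Ray T) : Prop :=
  ∃ Q : Ray T, Q.toSubgraph = R.toSubgraph ⊓ S.toSubgraph

/-- The ends of a tree: the equivalence classes of its rays. -/
def TreeEnd {V : Type u} (T : SimpleGraph V) : Type u :=
  {η : Set (Ray T) // ∃ R : Ray T, η = {S | RayEquiv R S}}

/-- `R` belongs to the end `η`, that is, `R` is an `η`-ray. -/
def IsEndRay {V : Type u} {T : SimpleGraph V} (η : TreeEnd T) (R : Ray T) : Prop := R ∈ η.1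

/-- The vertex `r` separates the vertex `x` from the end `η`: the `η`-ray that starts at `x`
passes through `r`. -/
def Separates {V : Type u} {T : SimpleGraph V} (r x : V) (η : TreeEnd T) : Prop :=
  ∃ R : Ray T, IsEndRay η R ∧ R 0 = x ∧ r ∈ Set.range R

/-- The sequence `x` of vertices converges to the end `η`. -/
def ConvergesTo {V : Type u} {T : SimpleGraph V} (x : ℕ → V) (η : TreeEnd T) : Prop :=
  ∃ R : Ray T, IsEndRay η R ∧ ∀ m : ℕ, {n : ℕ | Separates (R m) (x n) η}.Finite

/-- `f` fixes the end `η`: it maps `η`-rays to `η`-rays. -/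
def FixesEnd {V : Type u} {T : SimpleGraph V} (f : Copy T T) (η : TreeEnd T) : Prop :=
  ∀ R : Ray T, IsEndRay η R → IsEndRay η (f.comp R)

/-- `f` is elliptic: it maps some non-empty finite subtree of `T` onto itself. -/
def IsElliptic {V : Type u} {T : SimpleGraph V} (f : Copy T T) : Prop :=
  ∃ F : T.Subgraph, F.coe.IsTree ∧ F.verts.Finite ∧ F.map f.toHom = F

/-- `f` is parabolic: it is not elliptic and it fixes precisely one end. -/
def IsParabolic {V : Type u} {T : SimpleGraph V} (f : Copy T T) : Prop :=
  ¬ IsElliptic f ∧ ∃! η : TreeEnd T, FixesEnd f η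

/-- `η` is the direction `f⁺` of the non-elliptic embedding `f`: the end fixed by `f` to which the
sequences `x, f x, f (f x), …` converge. -/
def IsDirection {V : Type u} {T : SimpleGraph V} (f : Copy T T) (η : TreeEnd T) : Prop :=
  ¬ IsElliptic f ∧ FixesEnd f η ∧ ∀ x : V, ConvergesTo (fun n => f^[n] x) η

/-- The subgraph of `T` that consists of everything reachable from `r` without an edge of `R`. -/
def hangingTree {V : Type u} {T : SimpleGraph V} (R : Ray T) (r : V) : T.Subgraph where
  verts := {x | (T.deleteEdges R.toSubgraph.edgeSet).Reachable r x}
  Adj x y := (T.deleteEdges R.toSubgraph.edgeSet).Adj x y ∧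
    (T.deleteEdges R.toSubgraph.edgeSet).Reachable r x
  adj_sub h := (T.deleteEdges_le _) h.1
  edge_vert h := h.2
  symm := ⟨fun _ _ h => ⟨h.1.symm, h.2.trans h.1.reachable⟩⟩

/-- `hangingTree R r` is the maximal subtree of the tree `T` that contains `r` and is edge-disjoint
from `R`. -/
theorem isGreatest_hangingTree {V : Type u} {T : SimpleGraph V} (hT : T.IsTree) (R : Ray T)
    (r : V) :
    IsGreatest {H : T.Subgraph | H.coe.IsTree ∧ r ∈ H.verts ∧
      Disjoint H.edgeSet R.toSubgraph.edgeSet} (hangingTree R r) := by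
  refine ⟨⟨⟨?_, hT.2.subgraph _⟩, Reachable.refl r, ?_⟩, ?_⟩
  · have key : ∀ (x y : V) (p : (T.deleteEdges R.toSubgraph.edgeSet).Walk x y)
        (hx : x ∈ (hangingTree R r).verts) (hy : y ∈ (hangingTree R r).verts),
        (hangingTree R r).coe.Reachable ⟨x, hx⟩ ⟨y, hy⟩ := by
      intro x y p
      induction p with
      | nil => intro hx hy; exact Reachable.refl _
      | @cons a b c hab q ih =>
        intro hx hy
        have hb : b ∈ (hangingTree R r).verts := Reachable.trans hx hab.reachable
        have hadj : (hangingTree R r).coe.Adj ⟨a, hx⟩ ⟨b, hb⟩ := ⟨hab, hx⟩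
        exact hadj.reachable.trans (ih hb hy)
    have : Nonempty (hangingTree R r).verts := ⟨⟨r, Reachable.refl r⟩⟩
    refine ⟨?_⟩
    rintro ⟨x, hx⟩ ⟨y, hy⟩
    obtain ⟨p⟩ := (Reachable.symm hx).trans hy
    exact key x y p hx hy
  · rw [Set.disjoint_left]
    intro e
    induction e with
    | _ x y =>
      intro h h'
      have h1 : (T.deleteEdges R.toSubgraph.edgeSet).Adj x y := h.1
      rw [deleteEdges_adj] at h1
      exact h1.2 h'
  · rintro H ⟨hH, hr, hd⟩
    have hadj : ∀ {x y : V}, H.Adj x y → (T.deleteEdges R.toSubgraph.edgeSet).Adj x y := by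
      intro x y h
      rw [deleteEdges_adj]
      exact ⟨H.adj_sub h, Set.disjoint_left.1 hd h⟩
    let φ : H.coe →g T.deleteEdges R.toSubgraph.edgeSet := ⟨fun x => x.1, fun h => hadj h⟩
    have hreach : ∀ x ∈ H.verts, (T.deleteEdges R.toSubgraph.edgeSet).Reachable r x :=
      fun x hx => (hH.1.preconnected ⟨r, hr⟩ ⟨x, hx⟩).map φ
    exact ⟨hreach, fun x y h => ⟨hadj h, hreach x (H.edge_vert h)⟩⟩

/-- The ray `R` is regular: among the subtrees hanging off `R` at its vertices there are only
finitely many up to equimorphy. -/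
def IsRegularRay {V : Type u} {T : SimpleGraph V} (R : Ray T) : Prop :=
  ∃ s : Finset ℕ, ∀ n : ℕ, ∃ m ∈ s,
    Equimorphic (hangingTree R (R n)).coe (hangingTree R (R m)).coe

/-- An end is regular if it contains a regular ray. -/
def IsRegularEnd {V : Type u} {T : SimpleGraph V} (η : TreeEnd T) : Prop :=
  ∃ R : Ray T, IsEndRay η R ∧ IsRegularRay R

end TreeSib

/-! Let R be a regular ray in the direction. Up to a tail, f translates R by some d ≥ 1
(`IsDirection.exists_translation`). Since f fixes only one end, some iterate pushes all of T beyond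
any given edge of R (`IsParabolic.exists_iterate_mem_side`): otherwise R could be prolonged
backwards by preimages to a ray whose end is also fixed by f, and this end is not the direction.
Hence every connected vertex set that contains the part of T beyond some edge of R induces a
sibling, and the freedom lies in what is kept behind that edge.

If infinitely many branchings lie behind some edge of R, König's lemma gives a ray Q going away from
the direction with infinitely many branchings on it. Keep the part beyond the edge, the ray Q, and
single pendant vertices at an arbitrary set of these branchings. This gives uncountably many
siblings; an isomorphism class of countable trees accounts for only countably many of them, because
an isomorphism that fixes the first edge of Q determines the set (`IsDecoration.subset_of_iso`).

Otherwise each tree hanging off R has finitely many branchings. Regularity bounds their number, and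
f embeds the tree at R n into the one at R (n + d), so the numbers are eventually d-periodic and all
branchings far out are translates of earlier ones. They therefore stay at bounded distance from R
(`IsRegularRay.exists_dist_le`). Since T is not a ray, R has branchings at distance d from each
other. Keep the part beyond R k, a bare segment of R behind it, and one branching near the far end
of the segment. The length of the bare segment is then visible as an isolated branching, so
different lengths give non-isomorphic siblings (`not_nonempty_iso_spacedSet`). -/

namespace TreeSib

/-! ### Sides of an edge, branchings and embeddings of trees -/

section Side

variable {V : Type u} {W : Type v} {T : SimpleGraph V}

/-- The component of `b` after the edge `ab` has been removed. -/
def side (T : SimpleGraph V) (a b : V) : Set V := {x | (T.deleteEdges {s(a, b)}).Reachable b x}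

/-- A vertex with at least three neighbours. -/
def Branching (G : SimpleGraph V) (v : V) : Prop :=
  ∃ a b c, G.Adj v a ∧ G.Adj v b ∧ G.Adj v c ∧ a ≠ b ∧ a ≠ c ∧ b ≠ c

theorem reachable_induction {G : SimpleGraph V} {b : V} {P : V → Prop} (h0 : P b)
    (hs : ∀ x y, G.Reachable b x → P x → G.Adj x y → P y) {x : V} (hx : G.Reachable b x) : P x := by
  obtain ⟨p⟩ := hx
  have : ∀ (u x : V) (p : G.Walk u x), G.Reachable b u → P u → P x := by
    intro u x p
    induction p with
    | nil => exact fun _ h => h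
    | cons h q ih => exact fun hu hp => ih (hu.trans h.reachable) (hs _ _ hu hp h)
  exact this b x p (Reachable.refl b) h0

theorem mem_side_self (a b : V) : b ∈ side T a b := Reachable.refl b

theorem side_step {a b x y : V} (hx : x ∈ side T a b) (h : T.Adj x y) (hne : s(x, y) ≠ s(a, b)) :
    y ∈ side T a b :=
  Reachable.trans hx (Adj.reachable (deleteEdges_adj.2 ⟨h, hne⟩))

theorem side_induction {a b : V} {P : V → Prop} (h0 : P b)
    (hs : ∀ x y, x ∈ side T a b → P x → T.Adj x y → s(x, y) ≠ s(a, b) → P y) {x : V}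
    (hx : x ∈ side T a b) : P x :=
  reachable_induction h0
    (fun x y h hp hxy => hs x y h hp (deleteEdges_adj.1 hxy).1 (deleteEdges_adj.1 hxy).2) hx

theorem notMem_side_left (hT : T.IsAcyclic) {a b : V} (h : T.Adj a b) : a ∉ side T a b := by
  have := isAcyclic_iff_forall_adj_isBridge.1 hT h
  exact fun hx => this hx.symm

theorem disjoint_side (hT : T.IsAcyclic) {a b x : V} (h : T.Adj a b) (h1 : x ∈ side T a b)
    (h2 : x ∈ side T b a) : False := by
  unfold side at h2
  rw [Sym2.eq_swap] at h2
  exact notMem_side_left hT h (Reachable.trans h1 (Reachable.symm h2))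

theorem mem_side_or (hT : T.Connected) (a b x : V) : x ∈ side T a b ∨ x ∈ side T b a := by
  refine reachable_induction (P := fun x => x ∈ side T a b ∨ x ∈ side T b a)
    (Or.inl (mem_side_self a b)) ?_ (hT.preconnected b x)
  intro x y _ hx hxy
  by_cases hne : s(x, y) = s(a, b)
  · rcases Sym2.eq_iff.1 hne with ⟨rfl, rfl⟩ | ⟨rfl, rfl⟩
    · exact Or.inl (mem_side_self _ _)
    · exact Or.inr (mem_side_self _ _)
  · rcases hx with hx | hx
    · exact Or.inl (side_step hx hxy hne)
    · exact Or.inr (side_step hx hxy (by rwa [Sym2.eq_swap (a := b)]))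

theorem notMem_side_iff (hT : T.IsTree) {a b x : V} (h : T.Adj a b) :
    x ∉ side T a b ↔ x ∈ side T b a :=
  ⟨(mem_side_or hT.1 a b x).resolve_left, fun h1 h2 => disjoint_side hT.2 h h2 h1⟩

theorem side_subset_side (hT : T.IsAcyclic) {a b c : V} (hab : T.Adj a b) (hbc : T.Adj b c)
    (hca : c ≠ a) : side T b c ⊆ side T a b := by
  intro x hx
  refine side_induction (P := fun x => x ∈ side T a b) ?_ ?_ hx
  · refine side_step (mem_side_self a b) hbc ?_
    rw [Ne, Sym2.eq_iff]
    rintro (⟨_, rfl⟩ | ⟨_, rfl⟩)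
    · exact hbc.ne rfl
    · exact hca rfl
  · intro x y hx hx' hxy hne
    refine side_step hx' hxy ?_
    rw [Ne, Sym2.eq_iff]
    rintro (⟨rfl, rfl⟩ | ⟨rfl, rfl⟩)
    · exact notMem_side_left hT hab hx'
    · exact notMem_side_left hT hbc hx

/-- The edge ab is the only way out of this side, and using it visits a. -/
theorem notMem_side_of_walk_avoids {H : SimpleGraph W} (g : H →g T) {a b : V}
    (ha : a ∉ Set.range g) {x y : W} (hxy : H.Reachable x y) (hx : g x ∈ side T a b) :
    g y ∈ side T a b := by
  refine reachable_induction (P := fun y => g y ∈ side T a b) hx ?_ hxy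
  intro x y _ hx h
  refine side_step hx (g.map_adj h) ?_
  rw [Ne, Sym2.eq_iff]
  rintro (⟨h, -⟩ | ⟨-, h⟩)
  · exact ha ⟨_, h⟩
  · exact ha ⟨_, h⟩

/-- The image of a connected graph that meets both sides of `ab` contains `a`. -/
theorem mem_range_of_side {H : SimpleGraph W} (hH : H.Preconnected) (g : H →g T) {a b : V}
    {x y : W} (hx : g x ∈ side T a b) (hy : g y ∉ side T a b) : a ∈ Set.range g := by
  by_contra ha
  exact hy (notMem_side_of_walk_avoids g ha (hH x y) hx)

theorem map_side {H : SimpleGraph W} (g : Copy H T) {a b x : W} (hx : x ∈ side H a b) :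
    g x ∈ side T (g a) (g b) := by
  refine side_induction (P := fun x => g x ∈ side T (g a) (g b)) (mem_side_self _ _) ?_ hx
  intro x y _ hx hxy hne
  refine side_step hx (g.toHom.map_adj hxy) fun h => hne ?_
  exact Sym2.map.injective g.injective (by simpa using h)

theorem Branching.map {H : SimpleGraph W} (g : Copy H T) {x : W} (h : Branching H x) :
    Branching T (g x) := by
  obtain ⟨a, b, c, ha, hb, hc, h1, h2, h3⟩ := h
  exact ⟨g a, g b, g c, g.toHom.map_adj ha, g.toHom.map_adj hb, g.toHom.map_adj hc,
    g.injective.ne h1, g.injective.ne h2, g.injective.ne h3⟩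

theorem Branching.exists_third {G : SimpleGraph V} {x : V} (h : Branching G x) (u v : V) :
    ∃ w, G.Adj x w ∧ w ≠ u ∧ w ≠ v := by
  obtain ⟨a, b, c, ha, hb, hc, h1, h2, h3⟩ := h
  by_contra! H
  have hh : ∀ w, G.Adj x w → w = u ∨ w = v := fun w hw => by
    by_contra! h'
    exact h'.2 (H w hw h'.1)
  have := hh a ha
  have := hh b hb
  have := hh c hc
  grind

theorem eq_or_eq_of_not_branching {G : SimpleGraph V} {x u v w : V} (h : ¬ Branching G x)
    (hu : G.Adj x u) (hv : G.Adj x v) (huv : u ≠ v) (hw : G.Adj x w) : w = u ∨ w = v := by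
  by_contra! H
  exact h ⟨u, v, w, hu, hv, hw, huv, H.1.symm, H.2.symm⟩

/-- An injective homomorphism from a connected graph to an acyclic graph is isometric. -/
theorem dist_map {H : SimpleGraph W} (hH : H.Connected) (hT : T.IsAcyclic) (g : Copy H T)
    (x y : W) : T.dist (g x) (g y) = H.dist x y := by
  obtain ⟨p, hp, hl⟩ := hH.exists_path_of_dist x y
  have hr : T.Reachable (g x) (g y) := (hH.preconnected x y).map g.toHom
  obtain ⟨q, hq, hq'⟩ := hr.exists_path_of_dist
  have hp' : (p.map g.toHom).IsPath := hp.map g.injective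
  have h2 : p.map g.toHom = q :=
    congrArg Subtype.val ((hT.subsingleton_path _ _).elim ⟨p.map g.toHom, hp'⟩ ⟨q, hq⟩)
  rw [← hq', ← h2, Walk.length_map, hl]

theorem adj_of_adj_map {H : SimpleGraph W} (hH : H.Connected) (hT : T.IsAcyclic) (g : Copy H T)
    {x y : W} (h : T.Adj (g x) (g y)) : H.Adj x y := by
  rw [← dist_eq_one_iff_adj, ← dist_map hH hT g, dist_eq_one_iff_adj]
  exact h

/-- By local finiteness only finitely many vertices are joined to a fixed one by a walk of given
length. Countability is needed for Cantor's argument below. -/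
theorem countable_of_connected (hT : T.Connected) (hfin : ∀ v, (T.neighborSet v).Finite) :
    Countable V := by
  obtain ⟨o⟩ := hT.nonempty
  have hball : ∀ n : ℕ, {x | ∃ p : T.Walk x o, p.length = n}.Finite := by
    intro n
    induction n with
    | zero =>
      refine (Set.finite_singleton o).subset ?_
      rintro x ⟨p, hp⟩
      exact Walk.eq_of_length_eq_zero hp
    | succ n ih =>
      refine (ih.biUnion fun x _ => hfin x).subset ?_
      rintro x ⟨p, hp⟩
      cases p with
      | nil => simp at hp
      | cons h q =>
        simp only [Set.mem_iUnion]
        exact ⟨_, ⟨q, by simpa using hp⟩, h.symm⟩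
  have : (Set.univ : Set V) = ⋃ n : ℕ, {x | ∃ p : T.Walk x o, p.length = n} := by
    ext x
    obtain ⟨p⟩ := hT.preconnected x o
    simp only [Set.mem_univ, Set.mem_iUnion, true_iff]
    exact ⟨_, p, rfl⟩
  rw [← Set.countable_univ_iff, this]
  exact Set.countable_iUnion fun n => (hball n).countable

end Side

/-! ### Non-backtracking walks and their nested sides -/

section Sequence

variable {V : Type u} {T : SimpleGraph V} {Q : ℕ → V}

/-- The sequence `Q` of vertices is a walk that never turns back. -/
def NonBacktracking (T : SimpleGraph V) (Q : ℕ → V) : Prop :=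
  (∀ n, T.Adj (Q n) (Q (n + 1))) ∧ ∀ n, Q (n + 2) ≠ Q n

theorem NonBacktracking.side_subset (hQ : NonBacktracking T Q) (hT : T.IsAcyclic) {n k : ℕ}
    (h : n ≤ k) : side T (Q k) (Q (k + 1)) ⊆ side T (Q n) (Q (n + 1)) := by
  induction h with
  | refl => exact subset_rfl
  | step _ ih => exact (side_subset_side hT (hQ.1 _) (hQ.1 _) (hQ.2 _)).trans ih

theorem NonBacktracking.mem_side_iff (hQ : NonBacktracking T Q) (hT : T.IsAcyclic) {n k : ℕ} :
    Q k ∈ side T (Q n) (Q (n + 1)) ↔ n < k := by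
  constructor
  · intro h
    by_contra! hk
    exact notMem_side_left hT (hQ.1 k) (hQ.side_subset hT hk h)
  · intro h
    obtain ⟨m, rfl⟩ := Nat.exists_eq_add_of_lt h
    exact hQ.side_subset hT (by omega : n ≤ n + m) (mem_side_self _ _)

theorem NonBacktracking.injective (hQ : NonBacktracking T Q) (hT : T.IsAcyclic) :
    Function.Injective Q := by
  intro i j h
  by_contra hne
  rcases Nat.lt_or_gt_of_ne hne with hlt | hlt
  · have := (hQ.mem_side_iff hT).2 hlt
    rw [← h, hQ.mem_side_iff hT] at this
    omega
  · have := (hQ.mem_side_iff hT).2 hlt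
    rw [h, hQ.mem_side_iff hT] at this
    omega

/-- A walk from Q (n + 1) cannot leave Q, as each later vertex has only its two neighbours on Q. -/
theorem NonBacktracking.exists_eq_of_mem_side (hQ : NonBacktracking T Q)
    {n : ℕ} (hb : ∀ k, n < k → ¬ Branching T (Q k)) {x : V} (hx : x ∈ side T (Q n) (Q (n + 1))) :
    ∃ k, n < k ∧ x = Q k := by
  refine side_induction (P := fun x => ∃ k, n < k ∧ x = Q k) ⟨n + 1, by omega, rfl⟩ ?_ hx
  rintro x y _ ⟨k, hk, rfl⟩ hxy hne
  obtain ⟨m, rfl⟩ : ∃ m, k = m + 1 := ⟨k - 1, by omega⟩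
  rcases eq_or_eq_of_not_branching (hb _ hk) (hQ.1 m).symm (hQ.1 (m + 1)) (hQ.2 m).symm hxy
    with rfl | rfl
  · refine ⟨m, lt_of_le_of_ne (by omega) ?_, rfl⟩
    rintro rfl
    exact hne Sym2.eq_swap
  · exact ⟨m + 2, by omega, rfl⟩

/-- A vertex of the part of `T` between `Q n` and `Q (n + 2)` other than `Q (n + 1)` has all its
neighbours in this part. -/
theorem NonBacktracking.eq_of_adj_of_notMem (hQ : NonBacktracking T Q) (hT : T.IsAcyclic) {n : ℕ}
    {x v : V} (h1 : x ∈ side T (Q n) (Q (n + 1))) (h2 : x ∉ side T (Q (n + 1)) (Q (n + 2)))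
    (h : T.Adj x v)
    (hv : ¬ (v ∈ side T (Q n) (Q (n + 1)) ∧ v ∉ side T (Q (n + 1)) (Q (n + 2)))) :
    x = Q (n + 1) ∧ (v = Q n ∨ v = Q (n + 2)) := by
  by_cases hv1 : v ∈ side T (Q n) (Q (n + 1))
  · have hv2 : v ∈ side T (Q (n + 1)) (Q (n + 2)) := by
      by_contra hv2
      exact hv ⟨hv1, hv2⟩
    by_cases he : s(v, x) = s(Q (n + 1), Q (n + 2))
    · rcases Sym2.eq_iff.1 he with ⟨rfl, rfl⟩ | ⟨rfl, rfl⟩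
      · exact absurd hv2 (notMem_side_left hT (hQ.1 _))
      · exact ⟨rfl, Or.inr rfl⟩
    · exact absurd (side_step hv2 h.symm he) h2
  · by_cases he : s(x, v) = s(Q n, Q (n + 1))
    · rcases Sym2.eq_iff.1 he with ⟨rfl, rfl⟩ | ⟨rfl, rfl⟩
      · exact absurd h1 (notMem_side_left hT (hQ.1 _))
      · exact ⟨rfl, Or.inl rfl⟩
    · exact absurd (side_step h1 h he) hv1

end Sequence

/-! ### Equivalence of rays as having a common tail -/

section Rays

variable {V : Type u} {T : SimpleGraph V}

theorem Ray.adj (R : Ray T) (n : ℕ) : T.Adj (R n) (R (n + 1)) :=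
  R.toHom.map_adj (hasse_adj.2 (Or.inl (Order.covBy_add_one n)))

theorem Ray.nonBacktracking (R : Ray T) : NonBacktracking T R :=
  ⟨R.adj, fun n h => by have := R.injective h; omega⟩

/-- The ray with a given injective sequence of vertices. -/
def rayOfSequence (Q : ℕ → V) (hadj : ∀ n, T.Adj (Q n) (Q (n + 1)))
    (hinj : Function.Injective Q) : Ray T :=
  ⟨⟨Q, by
    intro a b h
    rcases hasse_adj.1 h with h | h
    · rw [Nat.covBy_iff_add_one_eq] at h
      subst h
      exact hadj a
    · rw [Nat.covBy_iff_add_one_eq] at h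
      subst h
      exact (hadj b).symm⟩, hinj⟩

theorem Ray.mem_edgeSet_iff (R : Ray T) {e : Sym2 V} :
    e ∈ R.toSubgraph.edgeSet ↔ ∃ n, e = s(R n, R (n + 1)) := by
  induction e with
  | _ x y =>
    simp only [Subgraph.mem_edgeSet, Subgraph.map_adj, Relation.Map, Subgraph.top_adj]
    constructor
    · rintro ⟨a, b, h, rfl, rfl⟩
      rcases hasse_adj.1 h with h | h
      · rw [Nat.covBy_iff_add_one_eq] at h
        subst h
        exact ⟨a, rfl⟩
      · rw [Nat.covBy_iff_add_one_eq] at h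
        subst h
        exact ⟨b, Sym2.eq_swap⟩
    · rintro ⟨n, h⟩
      rcases Sym2.eq_iff.1 h with ⟨rfl, rfl⟩ | ⟨rfl, rfl⟩
      · exact ⟨n, n + 1, hasse_adj.2 (Or.inl (Order.covBy_add_one n)), rfl, rfl⟩
      · exact ⟨n + 1, n, hasse_adj.2 (Or.inr (Order.covBy_add_one n)), rfl, rfl⟩

theorem Ray.mem_verts_iff (R : Ray T) {x : V} : x ∈ R.toSubgraph.verts ↔ ∃ n, R n = x := by
  simp [Subgraph.map_verts]

theorem Ray.toSubgraph_adj_iff (R : Ray T) {x y : V} :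
    R.toSubgraph.Adj x y ↔ ∃ n, s(x, y) = s(R n, R (n + 1)) := by
  rw [← Subgraph.mem_edgeSet, R.mem_edgeSet_iff]

/-- By injectivity a step down can only be followed by further steps down, and these cannot go on
forever in ℕ. -/
theorem eq_add_of_injective_of_step (q : ℕ → ℕ) (hq : Function.Injective q)
    (hs : ∀ n, q (n + 1) = q n + 1 ∨ q n = q (n + 1) + 1) (n : ℕ) : q n = q 0 + n := by
  have key : ∀ n, q (n + 1) = q n + 1 := by
    intro n
    by_contra h
    have h1 : q n = q (n + 1) + 1 := (hs n).resolve_left h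
    have h2 : ∀ k, q (n + k) = q (n + k + 1) + 1 := by
      intro k
      induction k with
      | zero => exact h1
      | succ k ih =>
        rcases hs (n + k + 1) with h | h
        · have := hq (show q (n + k + 1 + 1) = q (n + k) by omega)
          omega
        · exact h
    have h3 : ∀ k, q (n + k) + k = q n := by
      intro k
      induction k with
      | zero => rfl
      | succ k ih =>
        have := h2 k
        change q (n + k + 1) + (k + 1) = q n
        omega
    have := h3 (q n + 1)
    omega
  induction n with
  | zero => rfl
  | succ n ih => rw [key, ih]; rfl

theorem exists_shift_of_le {Q R : Ray T} (h : Q.toSubgraph ≤ R.toSubgraph) :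
    ∃ a, ∀ n, Q n = R (a + n) := by
  have h1 : ∀ n, ∃ k, R k = Q n := fun n => R.mem_verts_iff.1 (h.1 (Q.mem_verts_iff.2 ⟨n, rfl⟩))
  choose q hq using h1
  have hinj : Function.Injective q := fun i j hij => Q.injective (by
    change Q i = Q j
    rw [← hq, ← hq, hij])
  refine ⟨q 0, fun n => ?_⟩
  rw [← eq_add_of_injective_of_step q hinj ?_ n, hq]
  intro n
  obtain ⟨i, hi⟩ := R.toSubgraph_adj_iff.1 (h.2 (Q.toSubgraph_adj_iff.2 ⟨n, rfl⟩))
  rw [← hq, ← hq] at hi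
  rcases Sym2.eq_iff.1 hi with ⟨h1, h2⟩ | ⟨h1, h2⟩
  · have := R.injective h1
    have := R.injective h2
    omega
  · have := R.injective h1
    have := R.injective h2
    omega

/-- Two rays with a common tail. -/
def CommonTail (R S : ℕ → V) : Prop := ∃ a b, ∀ n, R (a + n) = S (b + n)

theorem CommonTail.symm {R S : ℕ → V} : CommonTail R S → CommonTail S R :=
  fun ⟨a, b, h⟩ => ⟨b, a, fun n => (h n).symm⟩

theorem CommonTail.trans {R S Q : ℕ → V} : CommonTail R S → CommonTail S Q → CommonTail R Q := by
  rintro ⟨a, b, h⟩ ⟨c, d, h'⟩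
  refine ⟨a + c, d + b, fun n => ?_⟩
  rw [add_assoc, h, show b + (c + n) = c + (b + n) by omega, h', add_assoc]

theorem RayEquiv.commonTail {R S : Ray T} (h : RayEquiv R S) : CommonTail R S := by
  obtain ⟨Q, hQ⟩ := h
  obtain ⟨a, ha⟩ := exists_shift_of_le (Q := Q) (R := R) (hQ ▸ inf_le_left)
  obtain ⟨b, hb⟩ := exists_shift_of_le (Q := Q) (R := S) (hQ ▸ inf_le_right)
  exact ⟨a, b, fun n => (ha n).symm.trans (hb n)⟩

/-- If the rays parted after a common vertex, their tails would lie in disjoint sides. -/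
theorem eq_shift_of_commonTail (hT : T.IsAcyclic) {R S : Ray T} (h : CommonTail R S) {i j : ℕ}
    (hij : R i = S j) (n : ℕ) : R (i + n) = S (j + n) := by
  obtain ⟨a, b, h⟩ := h
  induction n with
  | zero => exact hij
  | succ n ih =>
    by_contra hne
    have h1 := (R.nonBacktracking.mem_side_iff hT (n := i + n) (k := a + (i + j + n + 1))).2
      (by omega)
    have h2 := (S.nonBacktracking.mem_side_iff hT (n := j + n) (k := b + (i + j + n + 1))).2
      (by omega)
    rw [← h, ← ih] at h2
    have h3 : T.Adj (R (i + n)) (S (j + n + 1)) := ih ▸ S.adj (j + n)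
    exact disjoint_side hT h3 h2
      (side_subset_side hT h3.symm (R.adj (i + n)) hne h1)

theorem rayEquiv_of_commonTail (hT : T.IsAcyclic) {R S : Ray T} (h : CommonTail R S) :
    RayEquiv R S := by
  classical
  have hex : ∃ a, ∃ b, R a = S b := by
    obtain ⟨a, b, h⟩ := h
    exact ⟨a, b, h 0⟩
  -- From the first vertex of R on S onwards the rays agree, so the intersection is exactly this
  -- tail of R.
  obtain ⟨b, hb⟩ := Nat.find_spec hex
  set a := Nat.find hex with ha
  have hmin : ∀ i j, R i = S j → a ≤ i := fun i j hij => Nat.find_min' hex ⟨j, hij⟩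
  have hab := eq_shift_of_commonTail hT h hb
  refine ⟨rayOfSequence (fun n => R (a + n)) (fun n => R.adj _) fun i j hij => by
    have := R.injective hij
    omega, ?_⟩
  ext x y
  · rw [Ray.mem_verts_iff, Subgraph.verts_inf, Set.mem_inter_iff, Ray.mem_verts_iff,
      Ray.mem_verts_iff]
    constructor
    · rintro ⟨n, rfl⟩
      exact ⟨⟨a + n, rfl⟩, b + n, (hab n).symm⟩
    · rintro ⟨⟨i, rfl⟩, j, hj⟩
      obtain ⟨n, rfl⟩ := Nat.exists_eq_add_of_le (hmin i j hj.symm)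
      exact ⟨n, rfl⟩
  · rw [Subgraph.inf_adj, Ray.toSubgraph_adj_iff, Ray.toSubgraph_adj_iff, Ray.toSubgraph_adj_iff]
    constructor
    · rintro ⟨n, hn⟩
      exact ⟨⟨a + n, hn⟩, b + n, by
        rw [← hab, add_assoc, ← hab]
        exact hn⟩
    · rintro ⟨⟨i, hi⟩, j, hj⟩
      have : ∃ k, R i = S k := by
        rw [hi] at hj
        rcases Sym2.eq_iff.1 hj with ⟨h1, h2⟩ | ⟨h1, h2⟩
        exacts [⟨_, h1⟩, ⟨_, h1⟩]
      obtain ⟨k, hk⟩ := this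
      obtain ⟨n, rfl⟩ := Nat.exists_eq_add_of_le (hmin i k hk)
      exact ⟨n, hi⟩

theorem IsEndRay.commonTail {η : TreeEnd T} {R S : Ray T} (hR : IsEndRay η R)
    (hS : IsEndRay η S) : CommonTail R S := by
  obtain ⟨η, Q, rfl⟩ := η
  exact (RayEquiv.commonTail hR).symm.trans (RayEquiv.commonTail hS)

end Rays

/-! ### Translation along the direction and contraction towards it -/

section Dynamics

variable {V : Type u} {T : SimpleGraph V}

/-- The iterates of an embedding. -/
def iterateCopy (f : Copy T T) : ℕ → Copy T T
  | 0 => Copy.id T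
  | n + 1 => f.comp (iterateCopy f n)

theorem coe_iterateCopy (f : Copy T T) (n : ℕ) : ⇑(iterateCopy f n) = f^[n] := by
  induction n with
  | zero => rfl
  | succ n ih =>
    ext x
    rw [iterateCopy, Copy.comp_apply, ih, Function.iterate_succ_apply']

theorem FixesEnd.iterateCopy {f : Copy T T} {η : TreeEnd T} (h : FixesEnd f η) {R : Ray T}
    (hR : IsEndRay η R) (n : ℕ) : IsEndRay η ((iterateCopy f n).comp R) := by
  induction n with
  | zero => exact hR
  | succ n ih => exact h _ ih

/-- Along a ray of its direction, a non-elliptic embedding is eventually a translation towards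
the end. -/
theorem IsDirection.exists_translation {f : Copy T T} {η : TreeEnd T} (hη : IsDirection f η)
    {R : Ray T} (hR : IsEndRay η R) :
    ∃ n₀ d, 1 ≤ d ∧ ∀ n, n₀ ≤ n → f (R n) = R (n + d) := by
  obtain ⟨a, b, hab⟩ := IsEndRay.commonTail (hη.2.1 R hR) hR
  change ∀ n, f (R (a + n)) = R (b + n) at hab
  rcases lt_or_ge a b with hlt | hle
  · refine ⟨a, b - a, by omega, fun n hn => ?_⟩
    obtain ⟨k, rfl⟩ := Nat.exists_eq_add_of_le hn
    rw [hab]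
    congr 1
    omega
  -- If f does not advance along R, all rays f^k ∘ R pass through the same vertex of R, which then
  -- separates every f^k (R 0) from the end, against convergence.
  · exfalso
    obtain ⟨R', hR', hfin⟩ := hη.2.2 (R 0)
    obtain ⟨a', b', h'⟩ := IsEndRay.commonTail hR hR'
    have hiter : ∀ k, f^[k] (R (a' + b + k * (a - b))) = R (a' + b) := by
      intro k
      induction k with
      | zero => simp
      | succ k ih =>
        rw [Function.iterate_succ_apply]
        have := hab (a' + k * (a - b))
        rw [show a' + b + (k + 1) * (a - b) = a + (a' + k * (a - b)) by
          rw [add_mul]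
          omega, this, ← ih]
        congr 2
        omega
    refine (hfin (b' + b)).not_infinite ?_
    convert Set.infinite_univ (α := ℕ)
    rw [Set.eq_univ_iff_forall]
    intro k
    refine ⟨(iterateCopy f k).comp R, hη.2.1.iterateCopy hR k, ?_, ?_⟩
    · rw [Copy.comp_apply, coe_iterateCopy]
    · refine ⟨a' + b + k * (a - b), ?_⟩
      rw [Copy.comp_apply, coe_iterateCopy, hiter, h']

/-- The iterates of a parabolic embedding push the whole tree towards the direction. -/
theorem IsParabolic.exists_iterate_mem_side (hT : T.IsTree) {f : Copy T T} (hf : IsParabolic f)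
    {η : TreeEnd T} (hη : IsDirection f η) {R : Ray T} (hR : IsEndRay η R) (m : ℕ) :
    ∃ j, ∀ x, f^[j] x ∈ side T (R m) (R (m + 1)) := by
  obtain ⟨n₀, d, hd, htr⟩ := hη.exists_translation hR
  have hit : ∀ j n, n₀ ≤ n → f^[j] (R n) = R (n + j * d) := by
    intro j
    induction j with
    | zero => simp
    | succ j ih =>
      intro n hn
      rw [Function.iterate_succ_apply, htr n hn, ih _ (by omega)]
      congr 1
      ring
  suffices H : ∃ j, ∀ x, f^[j] x ∈ side T (R (m + n₀)) (R (m + n₀ + 1)) by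
    obtain ⟨j, hj⟩ := H
    exact ⟨j, fun x => R.nonBacktracking.side_subset hT.2 (by omega) (hj x)⟩
  by_contra! H
  have hinj : ∀ j, Function.Injective f^[j] := fun j => Function.Injective.iterate f.injective j
  set M := m + n₀ with hM
  -- The connected image of f^j meets both sides of the edge after R p, hence contains R p.
  have hrange : ∀ j p, M ≤ p → ∃ v, f^[j] v = R p := by
    intro j p hp
    obtain ⟨x, hx⟩ := H j
    have h1 : f^[j] (R (p + 1)) ∈ side T (R p) (R (p + 1)) := by
      rw [hit j _ (by omega), R.nonBacktracking.mem_side_iff hT.2]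
      omega
    have h2 : f^[j] x ∉ side T (R p) (R (p + 1)) :=
      fun h => hx (R.nonBacktracking.side_subset hT.2 hp h)
    rw [← coe_iterateCopy] at h1 h2
    obtain ⟨v, hv⟩ := mem_range_of_side hT.1.preconnected (iterateCopy f j).toHom h1 h2
    exact ⟨v, by rw [← coe_iterateCopy]; exact hv⟩
  have hle : ∀ k, k ≤ k * d := fun k => Nat.le_mul_of_pos_right k hd
  -- E k plays the role of R (M - k): f^k moves it forward by k * d. The index stays at least M
  -- because d ≥ 1.
  choose E hE using fun k => hrange k (M + k * d - k) (by have := hle k; omega)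
  have hE' : ∀ k j, f^[k + j] (E k) = R (M + (k + j) * d - k) := by
    intro k j
    have := hle k
    rw [Nat.add_comm k j, Function.iterate_add_apply, hE, hit _ _ (by omega)]
    congr 1
    rw [add_mul]
    omega
  have hEinj : Function.Injective E := by
    intro i j hij
    have h1 := hE' i j
    have h2 := hE' j i
    rw [hij, Nat.add_comm i j, h2] at h1
    have := R.injective h1
    have := hle (j + i)
    omega
  have hEadj : ∀ k, T.Adj (E k) (E (k + 1)) := by
    intro k
    refine adj_of_adj_map hT.1 hT.2 (iterateCopy f (k + 1)) ?_
    rw [coe_iterateCopy, hE' k 1, hE (k + 1)]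
    have := hle (k + 1)
    have h := R.adj (M + (k + 1) * d - (k + 1))
    rw [show M + (k + 1) * d - (k + 1) + 1 = M + (k + 1) * d - k by omega] at h
    exact h.symm
  let Er : Ray T := rayOfSequence E hEadj hEinj
  have hshift : ∀ k, f (E (k + d)) = E k := by
    intro k
    apply hinj (k + d)
    rw [← Function.iterate_succ_apply, hE' k d, hE' (k + d) 1]
    congr 1
    have := hle (k + d)
    rw [add_mul _ 1]
    omega
  let ζ : TreeEnd T := ⟨{S | RayEquiv Er S}, Er, rfl⟩
  have hζ : FixesEnd f ζ := by
    intro S hS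
    obtain ⟨a, b, hab⟩ := RayEquiv.commonTail (R := Er) (S := S) hS
    refine rayEquiv_of_commonTail hT.2 (R := Er) (S := f.comp S) ?_
    refine ⟨a, b + d, fun n => ?_⟩
    rw [Copy.comp_apply, add_assoc, ← hab]
    change E (a + n) = f (E (a + (d + n)))
    rw [← hshift]
    congr 2
    omega
  have hEζ : IsEndRay ζ Er := rayEquiv_of_commonTail hT.2 ⟨0, 0, fun _ => rfl⟩
  -- By uniqueness of the fixed end, E shares a tail with R. But f^k maps E k to an index of R below
  -- M + k * d, while a vertex far out on R is moved beyond that.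
  have hEη : IsEndRay η Er := by
    rw [hf.2.unique hη.2.1 hζ]
    exact hEζ
  obtain ⟨a, b, hab⟩ := IsEndRay.commonTail hEη hR
  have h1 : E (a + (M + n₀ + 1)) = R (b + (M + n₀ + 1)) := hab (M + n₀ + 1)
  have h2 := hE (a + (M + n₀ + 1))
  rw [h1, hit _ _ (by omega)] at h2
  have := R.injective h2
  have := hle (a + (M + n₀ + 1))
  omega

end Dynamics

/-! ### Siblings as induced subtrees -/

section Siblings

variable {V : Type u} {T : SimpleGraph V}

theorem equimorphic_induce {f : Copy T T} {W : Set V} {j : ℕ} (hj : ∀ x, f^[j] x ∈ W) :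
    Equimorphic (T.induce W) T := by
  refine ⟨⟨Copy.induce T W⟩, ⟨⟨⟨fun x => ⟨f^[j] x, hj x⟩, ?_⟩, ?_⟩⟩⟩
  · intro a b h
    have := (iterateCopy f j).toHom.map_adj h
    rw [Copy.coe_toHom, coe_iterateCopy] at this
    exact this
  · intro a b h
    exact Function.Injective.iterate f.injective j (congrArg Subtype.val h)

/-- A connected induced subgraph that contains the image of an iterate of a self-embedding is a
sibling. -/
def inducedSibling (hT : T.IsTree) {f : Copy T T} {W : Set V} {j : ℕ} (hj : ∀ x, f^[j] x ∈ W)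
    (hW : (T.induce W).Preconnected) : Sibling T where
  verts := W
  graph := T.induce W
  isTree := ⟨{ preconnected := hW, nonempty := ⟨⟨_, hj hT.1.nonempty.some⟩⟩ }, hT.2.induce W⟩
  equimorphic := equimorphic_induce hj

theorem reachable_induce_of_side {W : Set V} {a b : V} (h : side T a b ⊆ W) {x : V}
    (hx : x ∈ side T a b) :
    (T.induce W).Reachable ⟨b, h (mem_side_self a b)⟩ ⟨x, h hx⟩ := by
  have : ∃ hx : x ∈ W, (T.induce W).Reachable ⟨b, h (mem_side_self a b)⟩ ⟨x, hx⟩ := by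
    refine side_induction (P := fun x => ∃ hx : x ∈ W,
      (T.induce W).Reachable ⟨b, h (mem_side_self a b)⟩ ⟨x, hx⟩)
      ⟨h (mem_side_self a b), Reachable.refl _⟩ ?_ hx
    rintro x y hx ⟨hx', hr⟩ hxy hne
    refine ⟨h (side_step hx hxy hne), hr.trans (Adj.reachable ?_)⟩
    exact hxy
  exact this.2

theorem finite_quotient_of_siblingNumber_ne_top (h : siblingNumber T ≠ ⊤) :
    Finite (Quotient (Sibling.setoid T)) := by
  by_contra hn
  rw [not_finite_iff_infinite] at hn
  exact h ENat.card_eq_top_of_infinite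

end Siblings

/-! ### Infinitely many branchings behind an edge: a Cantor argument -/

section InfinitelyManyBranchings

variable {V : Type u} {T : SimpleGraph V}

theorem eq_or_mem_side_of_mem_side {a b x : V} (hx : x ∈ side T a b) :
    x = b ∨ ∃ c, T.Adj b c ∧ c ≠ a ∧ x ∈ side T b c := by
  refine side_induction (P := fun x => x = b ∨ ∃ c, T.Adj b c ∧ c ≠ a ∧ x ∈ side T b c)
    (Or.inl rfl) ?_ hx
  rintro x y _ (rfl | ⟨c, hc, hca, hxc⟩) hxy hne
  · refine Or.inr ⟨y, hxy, ?_, mem_side_self _ _⟩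
    rintro rfl
    exact hne Sym2.eq_swap
  · by_cases he : s(x, y) = s(b, c)
    · rcases Sym2.eq_iff.1 he with ⟨rfl, rfl⟩ | ⟨rfl, rfl⟩
      · exact Or.inr ⟨y, hc, hca, mem_side_self _ _⟩
      · exact Or.inl rfl
    · exact Or.inr ⟨c, hc, hca, side_step hxc hxy he⟩

/-- König's lemma: apart from b, the side of ab is covered by finitely many sides of edges at b, so
one of these again meets s in an infinite set. -/
theorem exists_nonBacktracking_of_infinite (hfin : ∀ v, (T.neighborSet v).Finite) {s : Set V}
    {a b : V} (hab : T.Adj a b) (hinf : (side T a b ∩ s).Infinite) :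
    ∃ Q : ℕ → V, NonBacktracking T Q ∧ Q 0 = a ∧ Q 1 = b ∧
      ∀ n, (side T (Q n) (Q (n + 1)) ∩ s).Infinite := by
  have step : ∀ p : {p : V × V // T.Adj p.1 p.2 ∧ (side T p.1 p.2 ∩ s).Infinite},
      ∃ c, T.Adj p.1.2 c ∧ c ≠ p.1.1 ∧ (side T p.1.2 c ∩ s).Infinite := by
    rintro ⟨⟨a, b⟩, hab, hinf⟩
    by_contra! H
    refine hinf (((Set.finite_singleton b).union (((hfin b).subset
      (Set.sep_subset (T.neighborSet b) (fun c => c ≠ a))).biUnion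
        (t := fun c => side T b c ∩ s) fun c hc => ?_)).subset ?_)
    · exact H c hc.1 hc.2
    · rintro x ⟨hx, hs⟩
      rcases eq_or_mem_side_of_mem_side hx with rfl | ⟨c, hc, hca, hxc⟩
      · exact Or.inl rfl
      · exact Or.inr (Set.mem_biUnion (x := c) ⟨hc, hca⟩ ⟨hxc, hs⟩)
  choose g h1 h2 h3 using step
  let F : ℕ → {p : V × V // T.Adj p.1 p.2 ∧ (side T p.1 p.2 ∩ s).Infinite} := fun n =>
    Nat.rec ⟨(a, b), hab, hinf⟩ (fun _ p => ⟨(p.1.2, g p), h1 p, h3 p⟩) n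
  exact ⟨fun n => (F n).1.1, ⟨fun n => (F n).2.1, fun n => h2 (F n)⟩, rfl, rfl,
    fun n => (F n).2.2⟩

/-- The vertices between `Q n` and `Q (n + 2)`. -/
def slab (T : SimpleGraph V) (Q : ℕ → V) (n : ℕ) : Set V :=
  side T (Q n) (Q (n + 1)) \ side T (Q (n + 1)) (Q (n + 2))

theorem NonBacktracking.mem_slab_iff {Q : ℕ → V} (hQ : NonBacktracking T Q) (hT : T.IsAcyclic)
    {n k : ℕ} : Q k ∈ slab T Q n ↔ k = n + 1 := by
  rw [slab, Set.mem_sdiff, hQ.mem_side_iff hT, hQ.mem_side_iff hT]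
  omega

theorem NonBacktracking.slab_disjoint {Q : ℕ → V} (hQ : NonBacktracking T Q) (hT : T.IsAcyclic)
    {n k : ℕ} {x : V} (hn : x ∈ slab T Q n) (hk : x ∈ slab T Q k) : n = k := by
  rcases lt_trichotomy n k with h | h | h
  · exact absurd (hQ.side_subset hT h hk.1) hn.2
  · exact h
  · exact absurd (hQ.side_subset hT h hn.1) hk.2

/-- A side of an edge, a ray `Q` from it, and pendant vertices `y n` at `Q (n + 2)` for `n ∈ A`. -/
def decoratedRay (T : SimpleGraph V) (Q : ℕ → V) {B : Set ℕ} (y : B → V) (A : Set B) : Set V :=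
  side T (Q 1) (Q 0) ∪ Set.range Q ∪ y '' A

/-- `y n` is a neighbour of `Q (n + 2)` off the ray `Q`. -/
def IsDecoration (T : SimpleGraph V) (Q : ℕ → V) {B : Set ℕ} (y : B → V) : Prop :=
  ∀ n : B, T.Adj (Q (n + 2)) (y n) ∧ y n ≠ Q (n + 1) ∧ y n ≠ Q (n + 3)

variable {Q : ℕ → V} {B : Set ℕ} {y : B → V}

theorem ray_mem_decoratedRay (A : Set B) (n : ℕ) : Q n ∈ decoratedRay T Q y A :=
  Or.inl (Or.inr ⟨n, rfl⟩)

theorem IsDecoration.mem_slab (hy : IsDecoration T Q y) (hQ : NonBacktracking T Q)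
    (hT : T.IsAcyclic) (n : B) : y n ∈ slab T Q (n + 1) := by
  by_contra h
  obtain ⟨-, h | h⟩ := hQ.eq_of_adj_of_notMem hT ((hQ.mem_slab_iff hT).2 rfl).1
    ((hQ.mem_slab_iff hT).2 rfl).2 (hy n).1 h
  · exact (hy n).2.1 h
  · exact (hy n).2.2 h

theorem IsDecoration.eq_of_mem_slab (hy : IsDecoration T Q y) (hQ : NonBacktracking T Q)
    (hT : T.IsAcyclic) {A : Set B} {n : ℕ} {x : V} (hx : x ∈ decoratedRay T Q y A)
    (hn : x ∈ slab T Q (n + 1)) : x = Q (n + 2) ∨ ∃ k ∈ A, (k : ℕ) = n ∧ x = y k := by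
  rcases hx with (hx | ⟨k, rfl⟩) | ⟨k, hk, rfl⟩
  · exact (disjoint_side hT (hQ.1 0) (hQ.side_subset hT (Nat.zero_le _) hn.1) hx).elim
  · rw [hQ.mem_slab_iff hT] at hn
    exact Or.inl (hn ▸ rfl)
  · have := hQ.slab_disjoint hT (hy.mem_slab hQ hT k) hn
    exact Or.inr ⟨k, hk, by omega, rfl⟩

theorem IsDecoration.eq_of_ray_adj (hy : IsDecoration T Q y) (hQ : NonBacktracking T Q)
    (hT : T.IsAcyclic) {A : Set B} {n : ℕ} {x : V} (hx : x ∈ decoratedRay T Q y A)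
    (h : T.Adj (Q (n + 2)) x) :
    x = Q (n + 1) ∨ x = Q (n + 3) ∨ ∃ k ∈ A, (k : ℕ) = n ∧ x = y k := by
  by_cases hs : x ∈ slab T Q (n + 1)
  · rcases hy.eq_of_mem_slab hQ hT hx hs with rfl | h'
    · exact (h.ne rfl).elim
    · exact Or.inr (Or.inr h')
  · obtain ⟨-, h | h⟩ := hQ.eq_of_adj_of_notMem hT ((hQ.mem_slab_iff hT).2 rfl).1
      ((hQ.mem_slab_iff hT).2 rfl).2 h hs
    · exact Or.inl h
    · exact Or.inr (Or.inl h)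

theorem IsDecoration.eq_of_adj (hy : IsDecoration T Q y) (hQ : NonBacktracking T Q)
    (hT : T.IsAcyclic) {A : Set B} {n : B} {x : V} (hx : x ∈ decoratedRay T Q y A)
    (h : T.Adj (y n) x) : x = Q (n + 2) := by
  have hn := hy.mem_slab hQ hT n
  by_cases hs : x ∈ slab T Q (n + 1)
  · rcases hy.eq_of_mem_slab hQ hT hx hs with rfl | ⟨k, -, hk, rfl⟩
    · rfl
    · rw [Subtype.ext hk] at h
      exact (h.ne rfl).elim
  · obtain ⟨h', -⟩ := hQ.eq_of_adj_of_notMem hT hn.1 hn.2 h hs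
    exact ((hy n).1.ne h'.symm).elim

theorem IsDecoration.preconnected (hy : IsDecoration T Q y) (hQ : NonBacktracking T Q)
    (A : Set B) : (T.induce (decoratedRay T Q y A)).Preconnected := by
  have h1 : ∀ n, (T.induce (decoratedRay T Q y A)).Reachable ⟨Q 0, ray_mem_decoratedRay A 0⟩
      ⟨Q n, ray_mem_decoratedRay A n⟩ := by
    intro n
    induction n with
    | zero => exact Reachable.refl _
    | succ n ih => exact ih.trans (Adj.reachable (hQ.1 n))
  have h2 : ∀ x, (T.induce (decoratedRay T Q y A)).Reachable ⟨Q 0, ray_mem_decoratedRay A 0⟩ x := by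
    rintro ⟨x, (hx | ⟨n, rfl⟩) | ⟨n, hn, rfl⟩⟩
    · exact reachable_induce_of_side (fun z hz => Or.inl (Or.inl hz)) hx
    · exact h1 n
    · exact (h1 (n + 2)).trans (Adj.reachable (hy n).1)
  exact fun x z => (h2 x).symm.trans (h2 z)

/-- The isomorphism must fix Q pointwise, since the only other way to continue is a pendant vertex,
which is a dead end. Then a third neighbour of Q (n + 2) must go to a third neighbour. -/
theorem IsDecoration.subset_of_iso (hy : IsDecoration T Q y) (hQ : NonBacktracking T Q)
    (hT : T.IsAcyclic) {A A' : Set B}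
    (ψ : T.induce (decoratedRay T Q y A) ≃g T.induce (decoratedRay T Q y A'))
    (h1 : ψ ⟨Q 1, ray_mem_decoratedRay A 1⟩ = ⟨Q 1, ray_mem_decoratedRay A' 1⟩)
    (h2 : ψ ⟨Q 2, ray_mem_decoratedRay A 2⟩ = ⟨Q 2, ray_mem_decoratedRay A' 2⟩) : A ⊆ A' := by
  have hinj := hQ.injective hT
  have hadj : ∀ {a b} (_ : (T.induce (decoratedRay T Q y A)).Adj a b),
      T.Adj (ψ a).1 (ψ b).1 := fun h => ψ.map_adj_iff.2 h
  have hne : ∀ {a b}, a ≠ b → (ψ a).1 ≠ (ψ b).1 := fun h h' => h (ψ.injective (Subtype.ext h'))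
  have key : ∀ n, (ψ ⟨Q (n + 1), ray_mem_decoratedRay A _⟩).1 = Q (n + 1) ∧
      (ψ ⟨Q (n + 2), ray_mem_decoratedRay A _⟩).1 = Q (n + 2) := by
    intro n
    induction n with
    | zero => exact ⟨congrArg Subtype.val h1, congrArg Subtype.val h2⟩
    | succ n ih =>
      refine ⟨ih.2, ?_⟩
      have e1 := hadj (a := ⟨Q (n + 2), ray_mem_decoratedRay A _⟩)
        (b := ⟨Q (n + 3), ray_mem_decoratedRay A _⟩) (hQ.1 (n + 2))
      have e2 := hadj (a := ⟨Q (n + 3), ray_mem_decoratedRay A _⟩)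
        (b := ⟨Q (n + 4), ray_mem_decoratedRay A _⟩) (hQ.1 (n + 3))
      have n1 := hne (a := ⟨Q (n + 3), ray_mem_decoratedRay A _⟩)
        (b := ⟨Q (n + 1), ray_mem_decoratedRay A _⟩)
        (fun h => by have := hinj (congrArg Subtype.val h); omega)
      have n2 := hne (a := ⟨Q (n + 4), ray_mem_decoratedRay A _⟩)
        (b := ⟨Q (n + 2), ray_mem_decoratedRay A _⟩)
        (fun h => by have := hinj (congrArg Subtype.val h); omega)
      rw [ih.2] at e1 n2
      rw [ih.1] at n1
      rcases hy.eq_of_ray_adj hQ hT (ψ _).2 e1 with h | h | ⟨k, hk, rfl, h⟩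
      · exact (n1 h).elim
      · exact h
      · rw [h] at e2
        exact (n2 (hy.eq_of_adj hQ hT (ψ _).2 e2)).elim
  intro n hn
  have hyn : y n ∈ decoratedRay T Q y A := Or.inr ⟨n, hn, rfl⟩
  have e := hadj (a := ⟨Q (n + 2), ray_mem_decoratedRay A _⟩) (b := ⟨y n, hyn⟩) (hy n).1
  have n1 := hne (a := ⟨y n, hyn⟩) (b := ⟨Q (n + 1), ray_mem_decoratedRay A _⟩)
    (fun h => (hy n).2.1 (congrArg Subtype.val h))
  have n2 := hne (a := ⟨y n, hyn⟩) (b := ⟨Q (n + 3), ray_mem_decoratedRay A _⟩)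
    (fun h => (hy n).2.2 (congrArg Subtype.val h))
  rw [(key n).2] at e
  rw [(key n).1] at n1
  rw [(key (n + 1)).2] at n2
  rcases hy.eq_of_ray_adj hQ hT (ψ _).2 e with h | h | ⟨k, hk, hkn, -⟩
  · exact (n1 h).elim
  · exact (n2 h).elim
  · rwa [← Subtype.ext hkn]

/-- If one side of an edge contains infinitely many branchings and an iterate of a self-embedding
maps into the other side, then there are infinitely many siblings. -/
theorem siblingNumber_eq_top_of_infinite_branching (hT : T.IsTree)
    (hfin : ∀ v, (T.neighborSet v).Finite) (f : Copy T T) {a b : V} (hab : T.Adj a b) {j : ℕ}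
    (hj : ∀ x, f^[j] x ∈ side T b a) (hinf : (side T a b ∩ {v | Branching T v}).Infinite) :
    siblingNumber T = ⊤ := by
  by_contra hne
  have := finite_quotient_of_siblingNumber_ne_top hne
  have := countable_of_connected hT.1 hfin
  obtain ⟨Q, hQ, rfl, rfl, hQinf⟩ := exists_nonBacktracking_of_infinite hfin hab hinf
  let B : Set ℕ := {n | Branching T (Q (n + 2))}
  -- Otherwise a late side would be a bare tail of Q, although it contains branchings.
  have hB : B.Infinite := by
    rw [Set.infinite_iff_exists_gt]
    by_contra! H
    obtain ⟨n, hn⟩ := H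
    have hn' : ∀ k, n + 2 < k → ¬ Branching T (Q k) := fun k hk hb => by
      have := hn (k - 2) (show Branching T (Q (k - 2 + 2)) by rwa [Nat.sub_add_cancel (by omega)])
      omega
    obtain ⟨x, hx, hbx⟩ := (hQinf (n + 2)).nonempty
    obtain ⟨k, hk, rfl⟩ := hQ.exists_eq_of_mem_side hn' hx
    exact hn' k hk hbx
  have : Infinite B := hB.to_subtype
  have hy : ∃ y : B → V, IsDecoration T Q y := by
    choose y hy using fun n : B => n.2.exists_third (Q (n + 1)) (Q (n + 3))
    exact ⟨y, hy⟩
  obtain ⟨y, hy⟩ := hy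
  let S : Set B → Sibling T := fun A => inducedSibling (W := decoratedRay T Q y A) hT
    (fun x => Or.inl (Or.inl (hj x))) (hy.preconnected hQ A)
  -- Representatives of the classes are named by vertices of T, so the class of a sibling and the
  -- images of Q 1 and Q 2 form a datum from a countable set.
  have he : ∀ q : Quotient (Sibling.setoid T), ∃ e : q.out.verts → V, Function.Injective e :=
    fun q => ⟨_, q.out.equimorphic.1.some.injective⟩
  choose e he using he
  have hS : ∀ A, ∃ q : Quotient (Sibling.setoid T), ∃ v₁ v₂ : V,
      ∃ φ : T.induce (decoratedRay T Q y A) ≃g q.out.graph,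
        e q (φ ⟨Q 1, ray_mem_decoratedRay A 1⟩) = v₁ ∧
        e q (φ ⟨Q 2, ray_mem_decoratedRay A 2⟩) = v₂ := by
    intro A
    obtain ⟨φ⟩ : Nonempty ((⟦S A⟧ : Quotient (Sibling.setoid T)).out.graph ≃g (S A).graph) :=
      Quotient.mk_out (S A)
    exact ⟨_, _, _, φ.symm, rfl, rfl⟩
  choose q v₁ v₂ hS using hS
  have hF : Function.Injective fun A => (q A, v₁ A, v₂ A) := by
    have hsub : ∀ A A', (q A, v₁ A, v₂ A) = (q A', v₁ A', v₂ A') → A ⊆ A' := by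
      intro A A' h
      obtain ⟨φ, h1, h2⟩ := hS A
      obtain ⟨φ', h1', h2'⟩ := hS A'
      simp only [Prod.mk.injEq] at h
      obtain ⟨hq, hv1, hv2⟩ := h
      rw [← hv1] at h1'
      rw [← hv2] at h2'
      clear hv1 hv2
      generalize q A = q₁ at *
      subst hq
      refine hy.subset_of_iso hQ hT.2 (φ.trans φ'.symm) ?_ ?_
      · apply φ'.injective
        simpa using he _ (h1.trans h1'.symm)
      · apply φ'.injective
        simpa using he _ (h2.trans h2'.symm)
    exact fun A A' h => (hsub A A' h).antisymm (hsub A' A h.symm)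
  have : Countable (Set B) := hF.countable
  obtain ⟨g, hg⟩ := exists_injective_nat (Set B)
  exact Function.cantor_injective _ ((Infinite.natEmbedding B).injective.comp hg)

end InfinitelyManyBranchings

/-! ### The trees hanging off a ray -/

section Hanging

variable {V : Type u} {T : SimpleGraph V} {R : Ray T}

theorem mem_hangingTree {r x : V} : x ∈ (hangingTree R r).verts ↔
    (T.deleteEdges R.toSubgraph.edgeSet).Reachable r x := Iff.rfl

theorem hangingTree_step {r x y : V} (hx : x ∈ (hangingTree R r).verts) (h : T.Adj x y)
    (he : ∀ i, s(x, y) ≠ s(R i, R (i + 1))) : y ∈ (hangingTree R r).verts := by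
  refine Reachable.trans (mem_hangingTree.1 hx) (Adj.reachable (deleteEdges_adj.2 ⟨h, ?_⟩))
  rw [R.mem_edgeSet_iff]
  exact fun ⟨i, hi⟩ => he i hi

theorem hangingTree_subset_side {n : ℕ} {a b : V} (i : ℕ) (h : s(a, b) = s(R i, R (i + 1)))
    (hb : b = R n) : (hangingTree R (R n)).verts ⊆ side T a b := by
  subst hb
  intro x hx
  refine Reachable.mono ?_ (mem_hangingTree.1 hx)
  refine deleteEdges_anti ?_
  rw [Set.singleton_subset_iff, R.mem_edgeSet_iff]
  exact ⟨i, h⟩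

theorem mem_side_iff_of_mem_hangingTree (hT : T.IsAcyclic) {n k : ℕ} {x : V}
    (hx : x ∈ (hangingTree R (R n)).verts) : x ∈ side T (R k) (R (k + 1)) ↔ k < n := by
  constructor
  · intro h
    by_contra! hn
    exact disjoint_side hT (R.adj n) (R.nonBacktracking.side_subset hT hn h)
      (hangingTree_subset_side n Sym2.eq_swap rfl hx)
  · intro h
    obtain ⟨m, rfl⟩ := Nat.exists_eq_add_of_lt h
    exact R.nonBacktracking.side_subset hT (by omega : k ≤ k + m)
      (hangingTree_subset_side (k + m) rfl rfl hx)

theorem hangingTree_index_unique (hT : T.IsAcyclic) {n m : ℕ} {x : V}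
    (hn : x ∈ (hangingTree R (R n)).verts) (hm : x ∈ (hangingTree R (R m)).verts) : n = m := by
  have h1 := fun k => (mem_side_iff_of_mem_hangingTree hT hn (k := k)).symm.trans
    (mem_side_iff_of_mem_hangingTree hT hm)
  have := h1 n
  have := h1 m
  omega

theorem ray_mem_hangingTree (n : ℕ) : R n ∈ (hangingTree R (R n)).verts := Reachable.refl _

theorem exists_mem_hangingTree (hT : T.Connected) (x : V) :
    ∃ n, x ∈ (hangingTree R (R n)).verts := by
  refine reachable_induction (P := fun x => ∃ n, x ∈ (hangingTree R (R n)).verts)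
    ⟨0, ray_mem_hangingTree 0⟩ ?_ (hT.preconnected (R 0) x)
  rintro x y _ ⟨n, hn⟩ hxy
  by_cases he : ∃ i, s(x, y) = s(R i, R (i + 1))
  · obtain ⟨i, hi⟩ := he
    rcases Sym2.eq_iff.1 hi with ⟨-, rfl⟩ | ⟨-, rfl⟩
    exacts [⟨_, ray_mem_hangingTree _⟩, ⟨_, ray_mem_hangingTree _⟩]
  · exact ⟨n, hangingTree_step hn hxy fun i hi => he ⟨i, hi⟩⟩

theorem hangingTree_adj_cases (hT : T.IsAcyclic) {n : ℕ} {x y : V}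
    (hx : x ∈ (hangingTree R (R n)).verts) (h : T.Adj x y) :
    y ∈ (hangingTree R (R n)).verts ∨ x = R n ∧ (y = R (n + 1) ∨ y = R (n - 1) ∧ 1 ≤ n) := by
  by_cases he : ∃ i, s(x, y) = s(R i, R (i + 1))
  · obtain ⟨i, hi⟩ := he
    rcases Sym2.eq_iff.1 hi with ⟨rfl, rfl⟩ | ⟨rfl, rfl⟩
    · obtain rfl := hangingTree_index_unique hT hx (ray_mem_hangingTree _)
      exact Or.inr ⟨rfl, Or.inl rfl⟩
    · obtain rfl := hangingTree_index_unique hT hx (ray_mem_hangingTree _)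
      exact Or.inr ⟨rfl, Or.inr ⟨rfl, by omega⟩⟩
  · exact Or.inl (hangingTree_step hx h fun i hi => he ⟨i, hi⟩)

theorem hangingTree_adj_of_mem (hT : T.IsAcyclic) {n : ℕ} {x y : V}
    (hx : x ∈ (hangingTree R (R n)).verts) (hy : y ∈ (hangingTree R (R n)).verts)
    (h : T.Adj x y) : (hangingTree R (R n)).Adj x y := by
  refine ⟨deleteEdges_adj.2 ⟨h, ?_⟩, hx⟩
  rw [R.mem_edgeSet_iff]
  rintro ⟨i, hi⟩
  rcases Sym2.eq_iff.1 hi with ⟨rfl, rfl⟩ | ⟨rfl, rfl⟩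
  · have h1 := hangingTree_index_unique hT hx (ray_mem_hangingTree _)
    have h2 := hangingTree_index_unique hT hy (ray_mem_hangingTree _)
    omega
  · have h1 := hangingTree_index_unique hT hx (ray_mem_hangingTree _)
    have h2 := hangingTree_index_unique hT hy (ray_mem_hangingTree _)
    omega

theorem index_le_add_length (hT : T.IsAcyclic) {x y : V} (p : T.Walk x y) {n m : ℕ}
    (hx : x ∈ (hangingTree R (R n)).verts) (hy : y ∈ (hangingTree R (R m)).verts) :
    m ≤ n + p.length := by
  induction p generalizing n with
  | nil => rw [hangingTree_index_unique hT hx hy]; omega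
  | cons h q ih =>
    rw [Walk.length_cons]
    rcases hangingTree_adj_cases hT hx h with h' | ⟨-, rfl | ⟨rfl, -⟩⟩
    · have := ih h' hy
      omega
    · have := ih (ray_mem_hangingTree _) hy
      omega
    · have := ih (ray_mem_hangingTree _) hy
      omega

theorem index_le_add_dist (hT : T.IsTree) {x y : V} {n m : ℕ}
    (hx : x ∈ (hangingTree R (R n)).verts) (hy : y ∈ (hangingTree R (R m)).verts) :
    m ≤ n + T.dist x y := by
  obtain ⟨p, hp⟩ := hT.1.exists_walk_length_eq_dist x y
  rw [← hp]
  exact index_le_add_length hT.2 p hx hy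

/-- The index of a hanging tree is determined by its position relative to the two edges of R at its
root, and f translates both edges. The strict bound on n is needed for the edge before R n. -/
theorem map_mem_hangingTree (hT : T.IsTree) (f : Copy T T) {n₀ d n : ℕ}
    (htr : ∀ n, n₀ ≤ n → f (R n) = R (n + d)) (hn : n₀ < n) {x : V}
    (hx : x ∈ (hangingTree R (R n)).verts) : f x ∈ (hangingTree R (R (n + d))).verts := by
  obtain ⟨p, hp⟩ := exists_mem_hangingTree (R := R) hT.1 (f x)
  obtain ⟨m, rfl⟩ : ∃ m, n = m + 1 := ⟨n - 1, by omega⟩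
  have h1 := map_side f (hangingTree_subset_side m rfl rfl hx)
  have h2 := map_side f (hangingTree_subset_side (m + 1) Sym2.eq_swap rfl hx)
  rw [htr m (by omega), htr (m + 1) (by omega), show m + 1 + d = m + d + 1 by omega,
    mem_side_iff_of_mem_hangingTree hT.2 hp] at h1
  rw [htr (m + 1 + 1) (by omega), htr (m + 1) (by omega),
    show m + 1 + 1 + d = m + d + 1 + 1 by omega, show m + 1 + d = m + d + 1 by omega,
    ← notMem_side_iff hT (R.adj _),
    mem_side_iff_of_mem_hangingTree hT.2 hp] at h2
  obtain rfl : p = m + 1 + d := by omega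
  exact hp

/-- A translation along the ray `R` maps the trees that hang off `R` into each other. -/
theorem exists_copy_hangingTree (hT : T.IsTree) (f : Copy T T) {n₀ d n : ℕ}
    (htr : ∀ n, n₀ ≤ n → f (R n) = R (n + d)) (hn : n₀ < n) :
    ∃ g : Copy (hangingTree R (R n)).coe (hangingTree R (R (n + d))).coe, ∀ x, (g x : V) = f x :=
  ⟨⟨⟨fun x => ⟨f x, map_mem_hangingTree hT f htr hn x.2⟩, fun {a b} h =>
    hangingTree_adj_of_mem hT.2 (map_mem_hangingTree hT f htr hn a.2)
      (map_mem_hangingTree hT f htr hn b.2) (f.toHom.map_adj h.1.1)⟩,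
    fun _ _ h => Subtype.ext (f.injective (congrArg Subtype.val h))⟩, fun _ => rfl⟩

theorem ncard_branching_le {A : Type*} {B : Type*} {G : SimpleGraph A} {H : SimpleGraph B}
    (g : Copy G H) (hfin : {x | Branching H x}.Finite) :
    {x | Branching G x}.ncard ≤ {x | Branching H x}.ncard :=
  Set.ncard_le_ncard_of_injOn g (fun _ h => Branching.map g h) g.injective.injOn hfin

theorem exists_branching_preimage {A : Type*} {B : Type*} {G : SimpleGraph A} {H : SimpleGraph B}
    (g : Copy G H) (hfin : {x | Branching H x}.Finite)
    (hle : {x | Branching H x}.ncard ≤ {x | Branching G x}.ncard) {z : B} (hz : Branching H z) :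
    ∃ x, Branching G x ∧ g x = z := by
  have hsub : g '' {x | Branching G x} ⊆ {x | Branching H x} := by
    rintro _ ⟨x, hx, rfl⟩
    exact Branching.map g hx
  have h1 := Set.eq_of_subset_of_ncard_le hsub
    (hle.trans_eq (Set.ncard_image_of_injective _ g.injective).symm) hfin
  have h2 : z ∈ g '' {x | Branching G x} := h1 ▸ hz
  exact h2

/-- The sum of d consecutive values is bounded and nondecreasing beyond n₀, and its increment is β
(n + d) - β n. Once the maximum is attained, all increments vanish. -/
theorem exists_forall_eq_add (β : ℕ → ℕ) {n₀ d C : ℕ} (hC : ∀ n, β n ≤ C)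
    (hmono : ∀ n, n₀ < n → β n ≤ β (n + d)) : ∃ N, n₀ < N ∧ ∀ n, N ≤ n → β (n + d) = β n := by
  let B : ℕ → ℕ := fun n => ∑ i ∈ Finset.range d, β (n + i)
  have hB : ∀ n, B (n + 1) + β n = B n + β (n + d) := by
    intro n
    have h1 := Finset.sum_range_succ (fun i => β (n + i)) d
    have h2 := Finset.sum_range_succ' (fun i => β (n + i)) d
    have h3 : B (n + 1) = ∑ i ∈ Finset.range d, β (n + (i + 1)) :=
      Finset.sum_congr rfl fun i _ => by congr 1; omega
    rw [h3]
    simp only [add_zero] at h2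
    rw [← h2, h1]
  have hbd : BddAbove (B '' Set.Ioi n₀) := by
    refine ⟨d * C, ?_⟩
    rintro _ ⟨n, -, rfl⟩
    simpa using Finset.sum_le_card_nsmul (Finset.range d) (fun i => β (n + i)) C fun i _ => hC _
  obtain ⟨N, hN, hNe⟩ := Nat.sSup_mem (Set.nonempty_Ioi.image B) hbd
  have hmax : ∀ n, n₀ < n → B n ≤ B N := fun n hn => hNe ▸ le_csSup hbd ⟨n, hn, rfl⟩
  have hN' : n₀ < N := hN
  have hst : ∀ n, n₀ < n → B n ≤ B (n + 1) := fun n hn => by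
    have := hB n
    have := hmono n hn
    omega
  have heq : ∀ n, N ≤ n → B N ≤ B n := by
    intro n hn
    induction n, hn using Nat.le_induction with
    | base => exact le_rfl
    | succ n hn ih => exact ih.trans (hst n (by omega))
  refine ⟨N, hN', fun n hn => ?_⟩
  have := hB n
  have := hmax n (by omega)
  have := hmax (n + 1) (by omega)
  have := heq n hn
  have := heq (n + 1) (by omega)
  omega

/-- If the trees hanging off a regular ray `R` have finitely many branchings each, and if `f` is
a translation along `R`, then these branchings are at bounded distance from `R`. -/
theorem IsRegularRay.exists_dist_le (hT : T.IsTree) (hreg : IsRegularRay R) (f : Copy T T)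
    {n₀ d : ℕ} (hd : 1 ≤ d) (htr : ∀ n, n₀ ≤ n → f (R n) = R (n + d))
    (hbr : ∀ m, (side T (R (m + 1)) (R m) ∩ {v | Branching T v}).Finite) :
    ∃ N M, ∀ n, N ≤ n → ∀ z ∈ (hangingTree R (R n)).verts, Branching T z → T.dist z (R n) ≤ M := by
  have hfin : ∀ n, {z | Branching (hangingTree R (R n)).coe z}.Finite := by
    intro n
    refine Set.Finite.of_finite_image ((hbr n).subset ?_) Subtype.val_injective.injOn
    rintro _ ⟨z, hz, rfl⟩
    exact ⟨hangingTree_subset_side n Sym2.eq_swap rfl z.2,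
      Branching.map (hangingTree R (R n)).coeCopy hz⟩
  let β : ℕ → ℕ := fun n => {z | Branching (hangingTree R (R n)).coe z}.ncard
  obtain ⟨s, hs⟩ := hreg
  have hC : ∀ n, β n ≤ ∑ m ∈ s, β m := by
    intro n
    obtain ⟨m, hm, ⟨g⟩, -⟩ := hs n
    exact (ncard_branching_le g (hfin m)).trans
      (Finset.single_le_sum (f := β) (fun _ _ => Nat.zero_le _) hm)
  obtain ⟨N, hN, hβ⟩ := exists_forall_eq_add β (n₀ := n₀) (d := d) hC fun n hn => by
    obtain ⟨g, -⟩ := exists_copy_hangingTree hT f htr hn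
    exact ncard_branching_le g (hfin _)
  have hM : ∀ n, ∃ M, ∀ z, Branching (hangingTree R (R n)).coe z → T.dist z (R n) ≤ M := by
    intro n
    obtain ⟨M, hM⟩ := 
      (Set.Finite.image (fun z : (hangingTree R (R n)).verts => T.dist z (R n)) (hfin n)).bddAbove
    exact ⟨M, fun z hz => hM ⟨z, hz, rfl⟩⟩
  choose M hM using hM
  -- Beyond N every branching is the image of one d steps earlier, at the same distance from its
  -- root. This leads back to the finitely many indices below N + d, and the sum dominates their
  -- bounds.
  have key : ∀ n, N ≤ n → ∀ z, Branching (hangingTree R (R n)).coe z →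
      T.dist z (R n) ≤ ∑ i ∈ Finset.range (N + d), M i := by
    intro n
    induction n using Nat.strong_induction_on with
    | _ n ih =>
      intro hn z hz
      rcases lt_or_ge n (N + d) with h | h
      · exact (hM n z hz).trans (Finset.single_le_sum (f := M) (fun _ _ => Nat.zero_le _)
          (Finset.mem_range.2 h))
      · obtain ⟨k, rfl⟩ : ∃ k, n = k + d := ⟨n - d, by omega⟩
        obtain ⟨g, hg⟩ := exists_copy_hangingTree hT f htr (n := k) (by omega)
        obtain ⟨x, hx, rfl⟩ := exists_branching_preimage g (hfin _) (hβ k (by omega)).le hz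
        rw [hg, ← htr k (by omega), dist_map hT.1 hT.2 f]
        exact ih k (by omega) (by omega) x hx
  refine ⟨N, ∑ i ∈ Finset.range (N + d), M i, fun n hn z hz hb => ?_⟩
  -- Only the root can lose neighbours in the hanging tree; any other vertex that branches in T also
  -- branches there.
  by_cases hzR : z = R n
  · rw [hzR, SimpleGraph.dist_self]
    exact Nat.zero_le _
  · refine key n hn ⟨z, hz⟩ ?_
    have hmem : ∀ {w}, T.Adj z w → w ∈ (hangingTree R (R n)).verts := fun h =>
      (hangingTree_adj_cases hT.2 hz h).resolve_right fun h' => hzR h'.1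
    obtain ⟨a, b, c, ha, hb, hc, h1, h2, h3⟩ := hb
    exact ⟨⟨a, hmem ha⟩, ⟨b, hmem hb⟩, ⟨c, hmem hc⟩, hangingTree_adj_of_mem hT.2 hz (hmem ha) ha,
      hangingTree_adj_of_mem hT.2 hz (hmem hb) hb, hangingTree_adj_of_mem hT.2 hz (hmem hc) hc,
      fun h => h1 (congrArg Subtype.val h), fun h => h2 (congrArg Subtype.val h),
      fun h => h3 (congrArg Subtype.val h)⟩

end Hanging

/-! ### Finitely many branchings behind each edge: bare segments of different lengths -/

section FinitelyManyBranchings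

variable {V : Type u} {T : SimpleGraph V} {R : Ray T}

/-- Without branchings the side is a tail of R, so f^j embeds T in a ray; the image is connected and
infinite, hence a tail of R from its least position on. -/
theorem isRay_of_not_branching (hT : T.IsTree) (hb : ∀ v, ¬ Branching T v) {f : Copy T T} {j : ℕ}
    (hj : ∀ x, f^[j] x ∈ side T (R 0) (R 1)) : IsRay T := by
  have hinj := Function.Injective.iterate f.injective j
  choose g _ hg using fun x => R.nonBacktracking.exists_eq_of_mem_side (fun k _ => hb _) (hj x)
  have hginj : Function.Injective g := fun x y h => hinj ((hg x).trans (h ▸ (hg y).symm))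
  have := hT.1.nonempty
  obtain ⟨x₀, hx₀⟩ : ∃ x₀, ∀ x, g x₀ ≤ g x := ⟨Function.argmin g, fun x => Function.argmin_le g x⟩
  have hrange : ∀ k, ∃ v, f^[j] v = R (g x₀ + k) := by
    intro k
    rcases Nat.eq_zero_or_pos k with rfl | hk
    · exact ⟨x₀, hg x₀⟩
    · obtain ⟨_, ⟨i, rfl⟩, hi⟩ :=
        (Set.infinite_range_of_injective (hginj.comp R.injective)).exists_gt (g x₀ + k)
      have hi' : g x₀ + k < g (R i) := hi
      have h1 : f^[j] (R i) ∈ side T (R (g x₀ + k)) (R (g x₀ + k + 1)) := by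
        rwa [hg, R.nonBacktracking.mem_side_iff hT.2]
      have h2 : f^[j] x₀ ∉ side T (R (g x₀ + k)) (R (g x₀ + k + 1)) := by
        rw [hg, R.nonBacktracking.mem_side_iff hT.2]
        omega
      rw [← coe_iterateCopy] at h1 h2
      obtain ⟨v, hv⟩ := mem_range_of_side hT.1.preconnected (iterateCopy f j).toHom h1 h2
      exact ⟨v, by rw [← coe_iterateCopy]; exact hv⟩
  choose ρ hρ using hrange
  have hgρ : ∀ k, g (ρ k) = g x₀ + k := fun k => R.injective ((hg _).symm.trans (hρ k))
  have hbij : Function.Bijective ρ := by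
    constructor
    · intro k l h
      have := hgρ k
      rw [h, hgρ l] at this
      omega
    · intro v
      refine ⟨g v - g x₀, hginj ?_⟩
      rw [hgρ]
      have := hx₀ v
      omega
  have hH : rayGraph.Connected := ⟨hasse_preconnected_of_succ ℕ⟩
  have hadj : ∀ k, T.Adj (ρ k) (ρ (k + 1)) := by
    intro k
    refine adj_of_adj_map hT.1 hT.2 (iterateCopy f j) ?_
    rw [coe_iterateCopy, hρ, hρ]
    exact R.adj _
  let S := rayOfSequence ρ hadj hbij.1
  exact ⟨(⟨Equiv.ofBijective ρ hbij, fun {k l} =>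
    ⟨fun h => adj_of_adj_map hH hT.2 S h, fun h => S.toHom.map_adj h⟩⟩ : rayGraph ≃g T).symm⟩

theorem dist_ray_le (hT : T.Connected) (a k : ℕ) : T.dist (R a) (R (a + k)) ≤ k := by
  induction k with
  | zero => simp
  | succ k ih =>
    have h1 := hT.dist_triangle (u := R a) (v := R (a + k)) (w := R (a + k + 1))
    rw [dist_eq_one_iff_adj.2 (R.adj (a + k))] at h1
    exact h1.trans (by omega)

/-- The part of `T` beyond `R k`, a segment of the ray `R`, and an additional vertex `y`. -/
def spacedSet (R : Ray T) (r : ℕ) (y : V) (k : ℕ) : Set V :=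
  side T (R k) (R (k + 1)) ∪ R '' Set.Icc r k ∪ {y}

variable {r k : ℕ} {y : V}

theorem ray_mem_spacedSet {n : ℕ} (hn : r ≤ n) (hT : T.IsAcyclic) : R n ∈ spacedSet R r y k := by
  rcases lt_or_ge k n with h | h
  · exact Or.inl (Or.inl ((R.nonBacktracking.mem_side_iff hT).2 h))
  · exact Or.inl (Or.inr ⟨n, ⟨hn, h⟩, rfl⟩)

theorem mem_spacedSet_of_adj (hrk : r ≤ k) {z w : V} (hz : z ∈ side T (R k) (R (k + 1)))
    (h : T.Adj z w) : w ∈ spacedSet R r y k := by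
  by_cases he : s(z, w) = s(R k, R (k + 1))
  · rcases Sym2.eq_iff.1 he with ⟨-, rfl⟩ | ⟨-, rfl⟩
    · exact Or.inl (Or.inl (mem_side_self _ _))
    · exact Or.inl (Or.inr ⟨k, ⟨hrk, le_rfl⟩, rfl⟩)
  · exact Or.inl (Or.inl (side_step hz h he))

theorem branching_spacedSet (hrk : r ≤ k) {z : V} (hz : z ∈ side T (R k) (R (k + 1)))
    (hb : Branching T z) :
    Branching (T.induce (spacedSet R r y k)) ⟨z, Or.inl (Or.inl hz)⟩ := by
  obtain ⟨a, b, c, ha, hb, hc, h1, h2, h3⟩ := hb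
  exact ⟨⟨a, mem_spacedSet_of_adj hrk hz ha⟩, ⟨b, mem_spacedSet_of_adj hrk hz hb⟩,
    ⟨c, mem_spacedSet_of_adj hrk hz hc⟩, ha, hb, hc, fun h => h1 (congrArg Subtype.val h),
    fun h => h2 (congrArg Subtype.val h), fun h => h3 (congrArg Subtype.val h)⟩

theorem branching_spacedSet_ray (hT : T.IsAcyclic) (hy : T.Adj (R (r + 1)) y) (h1 : y ≠ R r)
    (h2 : y ≠ R (r + 2)) :
    Branching (T.induce (spacedSet R r y k)) ⟨R (r + 1), ray_mem_spacedSet (by omega) hT⟩ :=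
  ⟨⟨R r, ray_mem_spacedSet le_rfl hT⟩, ⟨R (r + 2), ray_mem_spacedSet (by omega) hT⟩,
    ⟨y, Or.inr rfl⟩, (R.adj r).symm, R.adj (r + 1), hy,
    fun h => (R.nonBacktracking.2 r) (congrArg Subtype.val h).symm,
    fun h => h1 (congrArg Subtype.val h).symm, fun h => h2 (congrArg Subtype.val h).symm⟩

theorem mem_hangingTree_of_third (hT : T.IsAcyclic) (hy : T.Adj (R (r + 1)) y) (h1 : y ≠ R r)
    (h2 : y ≠ R (r + 2)) : y ∈ (hangingTree R (R (r + 1))).verts := by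
  rcases hangingTree_adj_cases hT (ray_mem_hangingTree _) hy with h | ⟨-, h | ⟨h, -⟩⟩
  · exact h
  · exact (h2 h).elim
  · exact (h1 h).elim

theorem eq_of_mem_spacedSet (hT : T.IsAcyclic) (hyr : y ∈ (hangingTree R (R (r + 1))).verts)
    {n : ℕ} (hn : n ≤ k) {z : V} (hz : z ∈ (hangingTree R (R n)).verts)
    (hzW : z ∈ spacedSet R r y k) : z = R n ∨ n = r + 1 ∧ z = y := by
  rcases hzW with (h | ⟨i, -, rfl⟩) | rfl
  · rw [mem_side_iff_of_mem_hangingTree hT hz] at h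
    omega
  · exact Or.inl (by rw [hangingTree_index_unique hT hz (ray_mem_hangingTree _)])
  · exact Or.inr ⟨hangingTree_index_unique hT hz hyr, rfl⟩

/-- Along the kept segment all hanging trees are cut off, except for the leaf y at R (r + 1). -/
theorem eq_or_mem_side_of_branching_spacedSet (hT : T.IsTree) (hy : T.Adj (R (r + 1)) y)
    (h1 : y ≠ R r) (h2 : y ≠ R (r + 2)) (z : spacedSet R r y k)
    (hz : Branching (T.induce (spacedSet R r y k)) z) :
    (z : V) = R (r + 1) ∨ (z : V) ∈ side T (R k) (R (k + 1)) := by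
  have hyr := mem_hangingTree_of_third hT.2 hy h1 h2
  obtain ⟨n, hn⟩ := exists_mem_hangingTree (R := R) hT.1 (z : V)
  rcases lt_or_ge k n with hkn | hkn
  · exact Or.inr ((mem_side_iff_of_mem_hangingTree hT.2 hn).2 hkn)
  left
  obtain ⟨a, b, c, ha, hb, hc, hab, hac, hbc⟩ := hz
  have third : ∀ u v : V, (∀ w : spacedSet R r y k, T.Adj z w → (w : V) = u ∨ (w : V) = v) →
      False := by
    intro u v H
    have := H a ha
    have := H b hb
    have := H c hc
    rw [Ne, Subtype.ext_iff] at hab hac hbc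
    grind
  rcases eq_of_mem_spacedSet hT.2 hyr hkn hn z.2 with hzn | ⟨rfl, hzy⟩
  · by_cases hnr : n = r + 1
    · rw [hzn, hnr]
    · refine (third (R (n + 1)) (R (n - 1)) fun w hw => ?_).elim
      rcases hangingTree_adj_cases hT.2 hn hw with h | ⟨-, h | ⟨h, -⟩⟩
      · rcases eq_of_mem_spacedSet hT.2 hyr hkn h w.2 with h | ⟨h, -⟩
        · rw [hzn, h] at hw
          exact (hw.ne rfl).elim
        · exact (hnr h).elim
      · exact Or.inl h
      · exact Or.inr h
  · refine (third (R (r + 1)) (R (r + 1)) fun w hw => Or.inl ?_).elim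
    rcases hangingTree_adj_cases hT.2 hn hw with h | ⟨h, -⟩
    · rcases eq_of_mem_spacedSet hT.2 hyr hkn h w.2 with h | ⟨-, h⟩
      · exact h
      · rw [hzy, h] at hw
        exact (hw.ne rfl).elim
    · rw [hzy] at h
      exact (hy.ne h.symm).elim

theorem preconnected_spacedSet (hy : T.Adj (R (r + 1)) y) (hT : T.IsAcyclic) (hrk : r + 1 ≤ k) :
    (T.induce (spacedSet R r y k)).Preconnected := by
  have hmem : ∀ n, R (r + n) ∈ spacedSet R r y k := fun n => ray_mem_spacedSet (by omega) hT
  have h1 : ∀ n, (T.induce (spacedSet R r y k)).Reachable ⟨R (r + 0), hmem 0⟩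
      ⟨R (r + n), hmem n⟩ := by
    intro n
    induction n with
    | zero => exact Reachable.refl _
    | succ n ih => exact ih.trans (Adj.reachable (R.adj (r + n)))
  have h2 : ∀ x, (T.induce (spacedSet R r y k)).Reachable ⟨R (r + 0), hmem 0⟩ x := by
    rintro ⟨x, (hx | ⟨n, ⟨hn, -⟩, rfl⟩) | rfl⟩
    · obtain ⟨m, rfl⟩ := Nat.exists_eq_add_of_le (show r ≤ k by omega)
      exact (h1 (m + 1)).trans (reachable_induce_of_side (fun z hz => Or.inl (Or.inl hz)) hx)
    · obtain ⟨m, rfl⟩ := Nat.exists_eq_add_of_le hn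
      exact h1 m
    · exact (h1 1).trans (Adj.reachable hy)
  exact fun x z => (h2 x).symm.trans (h2 z)

/-- Sets `spacedSet R r y k` and `spacedSet R r y l` with `k` and `l` far apart induce
non-isomorphic trees. -/
theorem not_nonempty_iso_spacedSet (hT : T.IsTree) (hy : T.Adj (R (r + 1)) y) (h1 : y ≠ R r)
    (h2 : y ≠ R (r + 2)) {d N M : ℕ} (hd : 1 ≤ d) (hbR : ∀ i, Branching T (R (r + 1 + i * d)))
    (hM : ∀ n, N ≤ n → ∀ z ∈ (hangingTree R (R n)).verts, Branching T z → T.dist z (R n) ≤ M)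
    {l : ℕ} (hkN : N + r + M + d + 1 ≤ k) (hkl : k + d ≤ l) :
    ¬ Nonempty (T.induce (spacedSet R r y l) ≃g T.induce (spacedSet R r y k)) := by
  rintro ⟨φ⟩
  have hcl : (T.induce (spacedSet R r y l)).Connected :=
    { preconnected := preconnected_spacedSet hy hT.2 (by omega), nonempty := ⟨⟨y, Or.inr rfl⟩⟩ }
  have hck : (T.induce (spacedSet R r y k)).Connected :=
    { preconnected := preconnected_spacedSet hy hT.2 (by omega), nonempty := ⟨⟨y, Or.inr rfl⟩⟩ }
  set p : spacedSet R r y l := ⟨R (r + 1), ray_mem_spacedSet (by omega) hT.2⟩ with hp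
  -- In the tree for l, all branchings other than p lie beyond R l, so at distance at least l - r
  -- from p. Subtrees are isometric in T, so φ carries this gap over to φ p.
  have hgap : ∀ z, Branching (T.induce (spacedSet R r y k)) z → z ≠ φ p →
      l + 1 ≤ r + 1 + T.dist (φ p : V) z := by
    intro z hz hne
    have hz' : Branching (T.induce (spacedSet R r y l)) (φ.symm z) := hz.map φ.symm.toCopy
    have hdist : T.dist (φ p : V) z = T.dist (R (r + 1)) (φ.symm z : V) := by
      have e1 := dist_map hck hT.2 (Copy.induce T _) (φ p) z
      have e2 := dist_map hcl hT.2 (Copy.induce T _) p (φ.symm z)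
      have e3 := dist_map hcl (hT.2.induce _) φ.toCopy p (φ.symm z)
      have e4 : φ.toCopy (φ.symm z) = z := φ.apply_symm_apply z
      rw [e4] at e3
      exact e1.trans (e3.trans e2.symm)
    rcases eq_or_mem_side_of_branching_spacedSet hT hy h1 h2 _ hz' with h | h
    · refine (hne ?_).elim
      have : φ.symm z = p := Subtype.ext h
      rw [← this, φ.apply_symm_apply]
    · obtain ⟨n, hn⟩ := exists_mem_hangingTree (R := R) hT.1 (φ.symm z : V)
      rw [mem_side_iff_of_mem_hangingTree hT.2 hn] at h
      have := index_le_add_dist hT (ray_mem_hangingTree (r + 1)) hn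
      rw [hdist]
      omega
  have hnext : ∀ n, r + 1 ≤ n → ∃ i, n < r + 1 + i * d ∧ r + 1 + i * d ≤ n + d := by
    intro n hn
    refine ⟨(n - (r + 1)) / d + 1, ?_, ?_⟩
    · have := Nat.lt_div_mul_add (a := n - (r + 1)) hd
      rw [add_mul]
      omega
    · have := Nat.div_mul_le_self (n - (r + 1)) d
      rw [add_mul]
      omega
  have hbp : Branching (T.induce (spacedSet R r y k)) (φ p) :=
    (branching_spacedSet_ray hT.2 hy h1 h2).map φ.toCopy
  have hfar : ∀ n, k < n → Branching T (R n) → R n ≠ φ p →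
      l + 1 ≤ r + 1 + T.dist (φ p : V) (R n) := fun n hn hb hne =>
    hgap _ (branching_spacedSet (by omega) ((R.nonBacktracking.mem_side_iff hT.2).2 hn) hb)
      fun h => hne (congrArg Subtype.val h)
  -- Either way another branching of the tree for k is too near to φ p: from R (r + 1) there is one
  -- on R before R (k + d + 1), and from a branching beyond R k one on R within M + d.
  rcases eq_or_mem_side_of_branching_spacedSet hT hy h1 h2 _ hbp with h | h
  · obtain ⟨i, hi, hi'⟩ := hnext k (by omega)
    have h3 := hfar _ hi (hbR i) (by
      rw [h]
      intro h
      have := R.injective h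
      omega)
    rw [h] at h3
    have := dist_ray_le (R := R) hT.1 (r + 1) (i * d)
    omega
  · obtain ⟨n, hn⟩ := exists_mem_hangingTree (R := R) hT.1 (φ p : V)
    rw [mem_side_iff_of_mem_hangingTree hT.2 hn] at h
    obtain ⟨i, hi, hi'⟩ := hnext n (by omega)
    have h3 := hfar _ (by omega) (hbR i) fun h => by
      rw [← h] at hn
      have := hangingTree_index_unique hT.2 hn (ray_mem_hangingTree _)
      omega
    have h4 := hM n (by omega) _ hn (hbp.map (Copy.induce T _))
    obtain ⟨m, hm⟩ := Nat.exists_eq_add_of_lt hi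
    have h5 := dist_ray_le (R := R) hT.1 n (m + 1)
    rw [← add_assoc, ← hm] at h5
    have h6 := hT.1.dist_triangle (u := (φ p : V)) (v := R n) (w := R (r + 1 + i * d))
    omega

theorem siblingNumber_eq_top_of_finite_branching (hT : T.IsTree) (hray : ¬ IsRay T) (f : Copy T T)
    {n₀ d : ℕ} (hd : 1 ≤ d) (htr : ∀ n, n₀ ≤ n → f (R n) = R (n + d))
    (hcontr : ∀ m, ∃ j, ∀ x, f^[j] x ∈ side T (R m) (R (m + 1))) (hreg : IsRegularRay R)
    (hbr : ∀ m, (side T (R (m + 1)) (R m) ∩ {v | Branching T v}).Finite) :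
    siblingNumber T = ⊤ := by
  obtain ⟨N, M, hM⟩ := hreg.exists_dist_le hT f hd htr hbr
  obtain ⟨v, hv⟩ : ∃ v, Branching T v := by
    by_contra! H
    obtain ⟨j, hj⟩ := hcontr 0
    exact hray (isRay_of_not_branching hT H hj)
  -- If R had no branching beyond R n₀, that part of T would be a bare tail of R, but an iterate of
  -- f maps v to a branching in it.
  obtain ⟨r, hr, hbR⟩ : ∃ r, n₀ ≤ r ∧ Branching T (R (r + 1)) := by
    by_contra! H
    have H' : ∀ k, n₀ < k → ¬ Branching T (R k) := fun k hk => by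
      obtain ⟨m, rfl⟩ : ∃ m, k = m + 1 := ⟨k - 1, by omega⟩
      exact H m (by omega)
    obtain ⟨j, hj⟩ := hcontr n₀
    obtain ⟨k, hk, hk'⟩ := R.nonBacktracking.exists_eq_of_mem_side H' (hj v)
    refine H' k hk ?_
    rw [← hk', ← coe_iterateCopy]
    exact hv.map _
  have hbR' : ∀ i, Branching T (R (r + 1 + i * d)) := by
    intro i
    induction i with
    | zero => simpa using hbR
    | succ i ih =>
      have := ih.map f
      rwa [htr _ (by omega), show r + 1 + i * d + d = r + 1 + (i + 1) * d by ring] at this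
  obtain ⟨y, hy, h1, h2⟩ := hbR.exists_third (R r) (R (r + 2))
  let κ : ℕ → ℕ := fun i => N + r + M + d + 1 + i * d
  choose j hj using hcontr
  let S : ℕ → Sibling T := fun i => inducedSibling (W := spacedSet R r y (κ i)) hT
    (fun x => Or.inl (Or.inl (hj (κ i) x)))
    (preconnected_spacedSet hy hT.2 (by simp only [κ]; omega))
  have hlt : ∀ i i', i < i' → (⟦S i'⟧ : Quotient (Sibling.setoid T)) ≠ ⟦S i⟧ := by
    intro i i' hii h
    refine not_nonempty_iso_spacedSet (k := κ i) (l := κ i') hT hy h1 h2 hd hbR' hM ?_ ?_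
      (Quotient.exact h)
    · simp only [κ]
      omega
    · simp only [κ]
      have := Nat.mul_le_mul_right d (Nat.succ_le_of_lt hii)
      rw [Nat.succ_mul] at this
      omega
  have hinj : Function.Injective fun i => (⟦S i⟧ : Quotient (Sibling.setoid T)) := by
    intro i i' h
    rcases lt_trichotomy i i' with h' | h' | h'
    · exact (hlt _ _ h' h.symm).elim
    · exact h'
    · exact (hlt _ _ h' h).elim
  have := Infinite.of_injective _ hinj
  exact ENat.card_eq_top_of_infinite

end FinitelyManyBranchings

end TreeSib

theorem mainTheorem4 {V : Type u} (T : SimpleGraph V) (hT : T.IsTree)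
    (hfin : ∀ v : V, (T.neighborSet v).Finite) (hray : ¬ TreeSib.IsRay T)
    (f : SimpleGraph.Copy T T) (hf : TreeSib.IsParabolic f)
    (η : TreeSib.TreeEnd T) (hη : TreeSib.IsDirection f η) (hreg : TreeSib.IsRegularEnd η) :
    TreeSib.siblingNumber T = ⊤ := by
  obtain ⟨R, hR, hreg⟩ := hreg
  obtain ⟨n₀, d, hd, htr⟩ := hη.exists_translation hR
  have hcontr := hf.exists_iterate_mem_side hT hη hR
  by_cases hbr : ∀ m, (TreeSib.side T (R (m + 1)) (R m) ∩ {v | TreeSib.Branching T v}).Finite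
  · exact TreeSib.siblingNumber_eq_top_of_finite_branching hT hray f hd htr hcontr hreg hbr
  · obtain ⟨m, hm⟩ := not_forall.1 hbr
    obtain ⟨j, hj⟩ := hcontr m
    exact TreeSib.siblingNumber_eq_top_of_infinite_branching hT hfin f (R.adj m).symm hj hm
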